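/- Fix $p\in(0,1)$. In Pemantle's model of the overhand shuffle of a (non-circular) deck of $n$ cards, one step of the Markov chain on $S_n$ is as follows: each of the $n-1$ slots between adjacent cards is, independently of the others, declared a cutpoint with probability $p$; the cutpoints divide the deck into packets of consecutive cards, and each packet is reversed in place, without changing its position relative to the other packets. Let $X^n_t$ be the deck after $t$ steps from a deterministic initial arrangement, let $U^n$ be the uniform distribution on $S_n$, let $\|\mu-\nu\|=\frac12\sum_s|\mu(s)-\nu(s)|$ be the total variation distance, and put $$f_p(n)=\frac{p^2(2-p)}{8\pi^2(1-p^2)}\,n^2\log n .$$ Then $f_p(n)$ is a lower bound for the mixing time, that is, for every choice of the initial arrangements, $$\lim_{n\to\infty}\bigl\|P\bigl(X^n_{\lfloor f_p(n)\rfloor}\in\cdot\bigr)-U^n\bigr\|=1 .$$ Moreover the mixing time is in this sense $\Omega(n^2\log n)$ at every level: for every $\varepsilon\in(0,1)$ and all sufficiently large $n$, for every initial arrangement, every $t\in\{0,1,2,\dots\}$ with $\|P(X^n_t\in\cdot)-U^n\|\le\varepsilon$ satisfies $t>f_p(n)$. -/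

import Mathlib

open Filter Topology

namespace OverhandShuffle

/-- Total variation distance `½ ∑ₛ |μ(s) - ν(s)|` of two mass functions on a finite set. -/
noncomputable def tvDist {S : Type*} [Fintype S] (μ ν : S → ℝ) : ℝ :=
  (1 / 2) * ∑ s, |μ s - ν s|

/-- The law at time `t` of the Markov chain with transition matrix `P` started at `x`. -/
noncomputable def lawAt {S : Type*} [Fintype S] [DecidableEq S]
    (P : Matrix S S ℝ) (x : S) (t : ℕ) : S → ℝ :=
  (P ^ t) x

/-- `f` is a lower bound for the mixing time of the sequence of chains with transition matrices
`P n` and stationary distributions `π n`: the total variation distance to stationarity at time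
`f n` (integer part) tends to `1`, whatever the initial states. -/
def IsMixingTimeLowerBound {S : ℕ → Type*} [∀ n, Fintype (S n)] [∀ n, DecidableEq (S n)]
    (P : ∀ n, Matrix (S n) (S n) ℝ) (π : ∀ n, S n → ℝ) (f : ℕ → ℝ) : Prop :=
  ∀ x : ∀ n, S n,
    Tendsto (fun n => tvDist (lawAt (P n) (x n) ⌊f n⌋₊) (π n)) atTop (𝓝 1)

/-- The uniform distribution on the permutations of `n` cards. -/
noncomputable def uniform (n : ℕ) : Equiv.Perm (Fin n) → ℝ :=
  fun _ => 1 / (Nat.factorial n : ℝ)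

/-- Positions in the deck are `0, …, n - 1`; slot `s` lies between the positions `s` and `s + 1`.
Two positions are in the same packet if no cutpoint separates them, that is, if every cutpoint
has both positions on the same side (position `i` is above slot `s` iff `i ≤ s`). -/
def SamePacket {n : ℕ} (C : Finset (Fin (n - 1))) (i j : Fin n) : Prop :=
  ∀ s ∈ C, (i.val ≤ s.val ↔ j.val ≤ s.val)

instance {n : ℕ} (C : Finset (Fin (n - 1))) (i j : Fin n) : Decidable (SamePacket C i j) :=
  inferInstanceAs (Decidable (∀ s ∈ C, (i.val ≤ s.val ↔ j.val ≤ s.val)))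

/-- The packet containing position `i`. -/
def packet {n : ℕ} (C : Finset (Fin (n - 1))) (i : Fin n) : Finset (Fin n) :=
  Finset.univ.filter (fun j => SamePacket C i j)

theorem mem_packet {n : ℕ} {C : Finset (Fin (n - 1))} {i j : Fin n} :
    j ∈ packet C i ↔ SamePacket C i j := by
  simp [packet]

theorem self_mem_packet {n : ℕ} (C : Finset (Fin (n - 1))) (i : Fin n) : i ∈ packet C i :=
  mem_packet.2 fun _ _ => Iff.rfl

/-- First position of the packet containing `i`. -/
def packetFirst {n : ℕ} (C : Finset (Fin (n - 1))) (i : Fin n) : Fin n :=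
  (packet C i).min' ⟨i, self_mem_packet C i⟩

/-- Last position of the packet containing `i`. -/
def packetLast {n : ℕ} (C : Finset (Fin (n - 1))) (i : Fin n) : Fin n :=
  (packet C i).max' ⟨i, self_mem_packet C i⟩

theorem packetFirst_le {n : ℕ} (C : Finset (Fin (n - 1))) (i : Fin n) :
    (packetFirst C i).val ≤ i.val :=
  Finset.min'_le _ _ (self_mem_packet C i)

theorem le_packetLast {n : ℕ} (C : Finset (Fin (n - 1))) (i : Fin n) :
    i.val ≤ (packetLast C i).val :=
  Finset.le_max' _ _ (self_mem_packet C i)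

/-- The image of position `i` when every packet is reversed in place. -/
def reverseFun {n : ℕ} (C : Finset (Fin (n - 1))) (i : Fin n) : Fin n :=
  ⟨(packetFirst C i).val + (packetLast C i).val - i.val, by
    have h1 := packetFirst_le C i
    have h2 := (packetLast C i).isLt
    omega⟩

theorem packet_reverseFun {n : ℕ} (C : Finset (Fin (n - 1))) (i : Fin n) :
    packet C (reverseFun C i) = packet C i := by
  have hf : SamePacket C i (packetFirst C i) := mem_packet.1 (Finset.min'_mem _ _)
  have hl : SamePacket C i (packetLast C i) := mem_packet.1 (Finset.max'_mem _ _)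
  have h1 := packetFirst_le C i
  have h2 := le_packetLast C i
  have h : SamePacket C i (reverseFun C i) := by
    intro s hs
    have a := hf s hs
    have b := hl s hs
    simp only [reverseFun]
    omega
  ext j
  rw [mem_packet, mem_packet]
  exact ⟨fun hj s hs => (h s hs).trans (hj s hs), fun hj s hs => (h s hs).symm.trans (hj s hs)⟩

theorem reverseFun_involutive {n : ℕ} (C : Finset (Fin (n - 1))) :
    Function.Involutive (reverseFun C) := by
  intro i
  have h1 := packetFirst_le C i
  have h2 := le_packetLast C i
  have hf : packetFirst C (reverseFun C i) = packetFirst C i := by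
    simp only [packetFirst, packet_reverseFun]
  have hl : packetLast C (reverseFun C i) = packetLast C i := by
    simp only [packetLast, packet_reverseFun]
  apply Fin.ext
  change (packetFirst C (reverseFun C i)).val + (packetLast C (reverseFun C i)).val
    - ((packetFirst C i).val + (packetLast C i).val - i.val) = i.val
  rw [hf, hl]
  omega

/-- The permutation of the positions that reverses each packet in place. -/
def reversePackets {n : ℕ} (C : Finset (Fin (n - 1))) : Equiv.Perm (Fin n) :=
  (reverseFun_involutive C).toPerm

/-- Probability that the set of cutpoints is exactly `C`, when each of the `n - 1` slots is a
cutpoint with probability `p`, independently of the others. -/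
noncomputable def cutProb (p : ℝ) {n : ℕ} (C : Finset (Fin (n - 1))) : ℝ :=
  p ^ C.card * (1 - p) ^ (n - 1 - C.card)

/-- Transition matrix of the overhand shuffle. A state `σ` is an arrangement of the deck: `σ k`
is the card at position `k`. With cutpoints `C` the card at position `k` moves to position
`reversePackets C k`, so (this being an involution) the new arrangement is
`σ * reversePackets C`. -/
noncomputable def transition (p : ℝ) (n : ℕ) :
    Matrix (Equiv.Perm (Fin n)) (Equiv.Perm (Fin n)) ℝ :=
  fun σ τ => ∑ C : Finset (Fin (n - 1)), if σ * reversePackets C = τ then cutProb p C else 0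

/-- The time `p²(2-p) / (8π²(1-p²)) · n² log n`. -/
noncomputable def lowerTime (p : ℝ) (n : ℕ) : ℝ :=
  p ^ 2 * (2 - p) / (8 * Real.pi ^ 2 * (1 - p ^ 2)) * (n : ℝ) ^ 2 * Real.log n

end OverhandShuffle

/-! The proof is Wilson's second moment method with an approximate eigenfunction. Put θ = π/n. In
the bulk of the deck the distances from a card to the two ends of its packet are nearly independent
geometric variables of variance (1-p)/p², so its displacement is nearly centred with variance
2(1-p)/p², and cos(θk) is contracted in mean by 1-γ with γ = θ²(1-p)/p². At the ends the
displacement has a drift, but there the derivative of the cosine is O(θ · distance to the end), so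
the boundary errors, summed over all cards, are only O(θ²) (`abs_cutExp_cos_sub_le`,
`abs_cutExp_score_sub_le`).

The statistic `testFun` pairs the cosines of the initial and the present position of each card. It
starts at n/2 (`testFun_self`), its drift error is η = O(n⁻²), and by Efron–Stein its one-step
variance is R = O(1/n), because a single slot affects only one packet (`cutExp_score_variance_le`).
Since γ is of order n⁻², η/γ is O(1) and R/γ is O(n): at every time, and under the uniform law, the
standard deviation is O(√n), while the uniform mean is O(1).

Up to time `lowerTime` one has γt ≤ (log n)/4, so the mean is still at least of order n^(5/8), well
above √n. Chebyshev's inequality then separates the two laws, uniformly in the starting arrangement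
and in t. This uniformity gives both halves of the theorem. -/

namespace OverhandShuffle

/-! ### Independent Bernoulli cutpoints and the Efron–Stein inequality. -/

section CutExpectation

variable {α : Type*}

/-- Expectation of `f` over a random subset of `S` containing each element independently with
probability `p`. -/
noncomputable def cutExp (p : ℝ) (S : Finset α) (f : Finset α → ℝ) : ℝ :=
  ∑ C ∈ S.powerset, p ^ C.card * (1 - p) ^ (S.card - C.card) * f C

theorem cutExp_add (p : ℝ) (S : Finset α) (f g : Finset α → ℝ) :
    cutExp p S (fun C => f C + g C) = cutExp p S f + cutExp p S g := by
  simp only [cutExp, mul_add, Finset.sum_add_distrib]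

theorem cutExp_sub (p : ℝ) (S : Finset α) (f g : Finset α → ℝ) :
    cutExp p S (fun C => f C - g C) = cutExp p S f - cutExp p S g := by
  simp only [cutExp, mul_sub, Finset.sum_sub_distrib]

theorem cutExp_const_mul (p : ℝ) (S : Finset α) (c : ℝ) (f : Finset α → ℝ) :
    cutExp p S (fun C => c * f C) = c * cutExp p S f := by
  simp only [cutExp, Finset.mul_sum]
  exact Finset.sum_congr rfl fun _ _ => by ring

theorem cutExp_sum {ι : Type*} (p : ℝ) (S : Finset α) (I : Finset ι) (f : ι → Finset α → ℝ) :
    cutExp p S (fun C => ∑ i ∈ I, f i C) = ∑ i ∈ I, cutExp p S (f i) := by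
  simp only [cutExp, Finset.mul_sum]
  exact Finset.sum_comm

theorem cutExp_mono {p : ℝ} (hp0 : 0 ≤ p) (hp1 : p ≤ 1) (S : Finset α) {f g : Finset α → ℝ}
    (h : ∀ C, f C ≤ g C) : cutExp p S f ≤ cutExp p S g := by
  have : 0 ≤ 1 - p := by linarith
  exact Finset.sum_le_sum fun C _ => mul_le_mul_of_nonneg_left (h C) (by positivity)

theorem cutExp_congr {p : ℝ} {S : Finset α} {f g : Finset α → ℝ}
    (h : ∀ C ⊆ S, f C = g C) : cutExp p S f = cutExp p S g :=
  Finset.sum_congr rfl fun C hC => by rw [h C (Finset.mem_powerset.1 hC)]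

variable [DecidableEq α]

theorem cutExp_insert (p : ℝ) {S : Finset α} {a : α} (ha : a ∉ S) (f : Finset α → ℝ) :
    cutExp p (insert a S) f
      = (1 - p) * cutExp p S f + p * cutExp p S (fun C => f (insert a C)) := by
  simp only [cutExp]
  rw [Finset.sum_powerset_insert ha, Finset.mul_sum, Finset.mul_sum]
  congr 1
  · refine Finset.sum_congr rfl fun C hC => ?_
    have h := Finset.card_le_card (Finset.mem_powerset.1 hC)
    rw [Finset.card_insert_of_notMem ha, Nat.succ_sub h, pow_succ]
    ring
  · refine Finset.sum_congr rfl fun C hC => ?_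
    have h : a ∉ C := fun h => ha (Finset.mem_powerset.1 hC h)
    rw [Finset.card_insert_of_notMem ha, Finset.card_insert_of_notMem h, Nat.add_sub_add_right,
      pow_succ]
    ring

theorem cutExp_uncut (p : ℝ) {S A : Finset α} (hA : A ⊆ S) :
    cutExp p S (fun C => if Disjoint A C then 1 else 0) = (1 - p) ^ A.card := by
  -- Replacing the weight p by 0 on A kills exactly the subsets that meet A; the product then has
  -- factor 1-p on A and 1 elsewhere.
  have h := Finset.prod_add (fun i => if i ∈ A then 0 else p) (fun _ => 1 - p) S
  have hl : ∏ i ∈ S, ((if i ∈ A then 0 else p) + (1 - p)) = (1 - p) ^ A.card := by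
    rw [← Finset.prod_subset hA (f := fun i => (if i ∈ A then 0 else p) + (1 - p))]
    · rw [Finset.prod_congr rfl (g := fun _ => 1 - p) (fun i hi => by simp [hi])]
      simp
    · intro i _ hi
      simp [hi]
  rw [← hl, h, cutExp]
  refine Finset.sum_congr rfl fun C hC => ?_
  rw [Finset.prod_const, Finset.card_sdiff_of_subset (Finset.mem_powerset.1 hC)]
  by_cases hd : Disjoint A C
  · rw [Finset.prod_congr rfl (g := fun _ => p)
      (fun i hi => by simp [Finset.disjoint_right.1 hd hi])]
    simp [hd]
  · obtain ⟨i, hiA, hiC⟩ := Finset.not_disjoint_iff.1 hd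
    rw [Finset.prod_eq_zero hiC (by simp [hiA])]
    simp [hd]

theorem cutExp_const (p : ℝ) (S : Finset α) (c : ℝ) : cutExp p S (fun _ => c) = c := by
  have h := cutExp_uncut p (Finset.empty_subset S)
  have h2 := cutExp_const_mul p S c (fun C => if Disjoint ∅ C then 1 else 0)
  rw [h] at h2
  simpa using h2

theorem sq_cutExp_le {p : ℝ} (hp0 : 0 ≤ p) (hp1 : p ≤ 1) (S : Finset α) (f : Finset α → ℝ) :
    cutExp p S f ^ 2 ≤ cutExp p S (fun C => f C ^ 2) := by
  set m := cutExp p S f with hm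
  have h : cutExp p S (fun C => 2 * m * f C - m ^ 2) ≤ cutExp p S (fun C => f C ^ 2) :=
    cutExp_mono hp0 hp1 S fun C => by nlinarith [sq_nonneg (f C - m)]
  rw [cutExp_sub, cutExp_const_mul, cutExp_const, ← hm] at h
  linarith

/-- Efron–Stein inequality for functions of independent Bernoulli variables. -/
theorem cutExp_variance_le {p : ℝ} (hp0 : 0 ≤ p) (hp1 : p ≤ 1) (S : Finset α)
    (f : Finset α → ℝ) :
    cutExp p S (fun C => f C ^ 2) - cutExp p S f ^ 2
      ≤ p * (1 - p) * ∑ s ∈ S, cutExp p S (fun C => (f (insert s C) - f (C.erase s)) ^ 2) := by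
  induction S using Finset.induction_on generalizing f with
  | empty => simp [cutExp]
  | insert a S ha ih =>
    have h0 := ih f
    have h1 := ih (fun C => f (insert a C))
    have hd : cutExp p (insert a S) (fun C => (f (insert a C) - f (C.erase a)) ^ 2)
        = cutExp p S (fun C => (f (insert a C) - f C) ^ 2) := by
      rw [cutExp_insert p ha]
      have e0 : cutExp p S (fun C => (f (insert a C) - f (C.erase a)) ^ 2)
          = cutExp p S (fun C => (f (insert a C) - f C) ^ 2) :=
        cutExp_congr fun C hC => by rw [Finset.erase_eq_of_notMem fun h => ha (hC h)]
      have e1 : cutExp p S (fun C => (f (insert a (insert a C)) - f ((insert a C).erase a)) ^ 2)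
          = cutExp p S (fun C => (f (insert a C) - f C) ^ 2) :=
        cutExp_congr fun C hC => by
          rw [Finset.insert_idem, Finset.erase_insert fun h => ha (hC h)]
      rw [e0, e1]
      ring
    have hs : ∀ s ∈ S, cutExp p (insert a S) (fun C => (f (insert s C) - f (C.erase s)) ^ 2)
        = (1 - p) * cutExp p S (fun C => (f (insert s C) - f (C.erase s)) ^ 2)
          + p * cutExp p S
            (fun C => (f (insert a (insert s C)) - f (insert a (C.erase s))) ^ 2) := by
      intro s hs
      have hne : a ≠ s := fun h => ha (h ▸ hs)
      rw [cutExp_insert p ha]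
      congr 3
      funext C
      rw [Finset.insert_comm, Finset.erase_insert_of_ne hne]
    rw [Finset.sum_insert ha, hd, Finset.sum_congr rfl hs, Finset.sum_add_distrib,
      ← Finset.mul_sum, ← Finset.mul_sum, cutExp_insert p ha, cutExp_insert p ha]
    -- Conditioning on whether a is cut, the variance is (1-p)V₀ + pV₁ + p(1-p)(m₁-m₀)². Induction
    -- handles V₀ and V₁, Jensen the last term.
    have hj := sq_cutExp_le hp0 hp1 S (fun C => f (insert a C) - f C)
    rw [cutExp_sub] at hj
    have hq : 0 ≤ 1 - p := by linarith
    have i0 := mul_le_mul_of_nonneg_left h0 hq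
    have i1 := mul_le_mul_of_nonneg_left h1 hp0
    have i2 := mul_le_mul_of_nonneg_left hj (mul_nonneg hp0 hq)
    linear_combination i0 + i1 + i2

end CutExpectation

/-! ### Distances from a card to the ends of its packet. -/

section Gaps

/-- Distance from position `k` to the first position of its packet. -/
def gapLeft {n : ℕ} (C : Finset (Fin (n - 1))) (k : Fin n) : ℕ :=
  k.val - (packetFirst C k).val

/-- Distance from position `k` to the last position of its packet. -/
def gapRight {n : ℕ} (C : Finset (Fin (n - 1))) (k : Fin n) : ℕ :=
  (packetLast C k).val - k.val

/-- The slots `s` with `a ≤ s < b`. -/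
def slots (n a b : ℕ) : Finset (Fin (n - 1)) :=
  Finset.univ.filter fun s => a ≤ s.val ∧ s.val < b

theorem card_slots {n a b : ℕ} (hb : b ≤ n - 1) : (slots n a b).card = b - a := by
  rw [← Nat.card_Ico a b, ← Finset.card_map Fin.valEmbedding]
  congr 1
  ext s
  simp only [slots, Finset.mem_map, Finset.mem_filter, Finset.mem_univ, true_and,
    Fin.valEmbedding_apply, Finset.mem_Ico]
  constructor
  · rintro ⟨t, h, rfl⟩
    exact h
  · intro h
    exact ⟨⟨s, by omega⟩, h, rfl⟩

theorem disjoint_slots {n a b : ℕ} {C : Finset (Fin (n - 1))} :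
    Disjoint (slots n a b) C ↔ ∀ s ∈ C, ¬(a ≤ s.val ∧ s.val < b) := by
  rw [Finset.disjoint_right]
  simp [slots]

theorem samePacket_packetFirst {n : ℕ} (C : Finset (Fin (n - 1))) (k : Fin n) :
    SamePacket C k (packetFirst C k) := mem_packet.1 (Finset.min'_mem _ _)

theorem samePacket_packetLast {n : ℕ} (C : Finset (Fin (n - 1))) (k : Fin n) :
    SamePacket C k (packetLast C k) := mem_packet.1 (Finset.max'_mem _ _)

theorem SamePacket.packetFirst_le {n : ℕ} {C : Finset (Fin (n - 1))} {k i : Fin n}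
    (h : SamePacket C k i) : (packetFirst C k).val ≤ i.val :=
  Finset.min'_le _ _ (mem_packet.2 h)

theorem SamePacket.le_packetLast {n : ℕ} {C : Finset (Fin (n - 1))} {k i : Fin n}
    (h : SamePacket C k i) : i.val ≤ (packetLast C k).val :=
  Finset.le_max' _ _ (mem_packet.2 h)

/-- Tail events of the gaps are events that a block of slots is uncut, whose probability
`cutExp_uncut` gives. The condition on j keeps the block inside the deck. -/
theorem le_gapLeft_iff {n j : ℕ} (C : Finset (Fin (n - 1))) (k : Fin n) (hj : j ≤ k.val) :
    j ≤ gapLeft C k ↔ Disjoint (slots n (k.val - j) k.val) C := by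
  rw [disjoint_slots, gapLeft]
  have h1 := packetFirst_le C k
  constructor
  · intro h s hs hs'
    have := samePacket_packetFirst C k s hs
    omega
  · intro h
    have hp : SamePacket C k ⟨k.val - j, by omega⟩ := by
      intro s hs
      have := h s hs
      simp only
      omega
    have := hp.packetFirst_le
    simp only at this
    omega

theorem le_gapRight_iff {n j : ℕ} (C : Finset (Fin (n - 1))) (k : Fin n) (hj : k.val + j < n) :
    j ≤ gapRight C k ↔ Disjoint (slots n k.val (k.val + j)) C := by
  rw [disjoint_slots, gapRight]
  have h1 := le_packetLast C k
  constructor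
  · intro h s hs hs'
    have := samePacket_packetLast C k s hs
    omega
  · intro h
    have hp : SamePacket C k ⟨k.val + j, hj⟩ := by
      intro s hs
      have := h s hs
      simp only
      omega
    have := hp.le_packetLast
    simp only at this
    omega

theorem gapLeft_le {n : ℕ} (C : Finset (Fin (n - 1))) (k : Fin n) : gapLeft C k ≤ k.val :=
  Nat.sub_le _ _

theorem gapRight_le {n : ℕ} (C : Finset (Fin (n - 1))) (k : Fin n) :
    gapRight C k ≤ n - 1 - k.val := by
  have := (packetLast C k).isLt
  simp only [gapRight]
  omega

theorem reversePackets_val {n : ℕ} (C : Finset (Fin (n - 1))) (k : Fin n) :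
    ((reversePackets C k).val : ℝ) = k.val + ((gapRight C k : ℝ) - gapLeft C k) := by
  have h1 := packetFirst_le C k
  have h2 := le_packetLast C k
  have h : (reversePackets C k).val = (packetFirst C k).val + (packetLast C k).val - k.val := rfl
  rw [h, gapLeft, gapRight, Nat.cast_sub (by omega), Nat.cast_sub h1, Nat.cast_sub h2]
  push_cast
  ring

end Gaps

/-! ### Moments of the gaps and of the displacement. -/

section Moments

/-- Discrete layer-cake formula: it reduces every moment of a gap to its geometric tails. -/
theorem eq_add_sum_tail (F : ℕ → ℝ) {X N : ℕ} (h : X ≤ N) :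
    F X = F 0 + ∑ j ∈ Finset.range N, (F (j + 1) - F j) * (if j + 1 ≤ X then 1 else 0) := by
  have : ∑ j ∈ Finset.range N, (F (j + 1) - F j) * (if j + 1 ≤ X then (1 : ℝ) else 0)
      = ∑ j ∈ Finset.range X, (F (j + 1) - F j) := by
    rw [← Finset.sum_subset (Finset.range_mono h)]
    · refine Finset.sum_congr rfl fun j hj => ?_
      have : j + 1 ≤ X := Finset.mem_range.1 hj
      simp [this]
    · intro j _ hj
      have : ¬ j + 1 ≤ X := fun h => hj (Finset.mem_range.2 h)
      simp [this]
  rw [this, Finset.sum_range_sub]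
  ring

theorem cutExp_eq_of_tail {α : Type*} (p : ℝ) (S : Finset α) (F : ℕ → ℝ)
    {X : Finset α → ℕ} {N : ℕ} (hX : ∀ C, X C ≤ N) [DecidableEq α] :
    cutExp p S (fun C => F (X C)) = F 0 + ∑ j ∈ Finset.range N,
      (F (j + 1) - F j) * cutExp p S (fun C => if j + 1 ≤ X C then 1 else 0) := by
  rw [cutExp_congr (g := fun C => F 0 + ∑ j ∈ Finset.range N,
    (F (j + 1) - F j) * (if j + 1 ≤ X C then 1 else 0)) fun C _ => eq_add_sum_tail F (hX C),
    cutExp_add, cutExp_const, cutExp_sum]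
  simp only [cutExp_const_mul]

theorem cutExp_le_gapLeft (p : ℝ) {n j : ℕ} (k : Fin n) (hj : j ≤ k.val) :
    cutExp p Finset.univ (fun C => if j ≤ gapLeft C k then 1 else 0) = (1 - p) ^ j := by
  simp only [le_gapLeft_iff _ k hj]
  rw [cutExp_uncut p (Finset.subset_univ _), card_slots (by omega)]
  congr 1
  omega

theorem cutExp_le_gapRight (p : ℝ) {n j : ℕ} (k : Fin n) (hj : k.val + j < n) :
    cutExp p Finset.univ (fun C => if j ≤ gapRight C k then 1 else 0) = (1 - p) ^ j := by
  simp only [le_gapRight_iff _ k hj]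
  rw [cutExp_uncut p (Finset.subset_univ _), card_slots (by omega)]
  congr 1
  omega

/-- The two blocks of slots are adjacent and disjoint, so together they form one block of i + j
slots. This is the independence of the two gaps. -/
theorem cutExp_le_gapLeft_mul_le_gapRight (p : ℝ) {n i j : ℕ} (k : Fin n) (hi : i ≤ k.val)
    (hj : k.val + j < n) :
    cutExp p Finset.univ (fun C => (if i ≤ gapLeft C k then 1 else 0) *
      (if j ≤ gapRight C k then 1 else 0)) = (1 - p) ^ (i + j) := by
  have h : ∀ C : Finset (Fin (n - 1)), (if i ≤ gapLeft C k then (1 : ℝ) else 0) *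
      (if j ≤ gapRight C k then 1 else 0)
      = if Disjoint (slots n (k.val - i) (k.val + j)) C then 1 else 0 := by
    intro C
    rw [ite_zero_mul_ite_zero, mul_one]
    refine if_congr ?_ rfl rfl
    rw [le_gapLeft_iff _ k hi, le_gapRight_iff _ k hj, disjoint_slots, disjoint_slots,
      disjoint_slots]
    constructor
    · rintro ⟨a, b⟩ s hs
      have := a s hs
      have := b s hs
      omega
    · intro a
      exact ⟨fun s hs => by have := a s hs; omega, fun s hs => by have := a s hs; omega⟩
  simp only [h]
  rw [cutExp_uncut p (Finset.subset_univ _), card_slots (by omega)]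
  congr 1
  omega

theorem cutExp_gapLeft (p : ℝ) {n : ℕ} (k : Fin n) (F : ℕ → ℝ) :
    cutExp p Finset.univ (fun C => F (gapLeft C k))
      = F 0 + ∑ j ∈ Finset.range k.val, (F (j + 1) - F j) * (1 - p) ^ (j + 1) := by
  rw [cutExp_eq_of_tail p _ F (fun C => gapLeft_le C k)]
  congr 1
  refine Finset.sum_congr rfl fun j hj => ?_
  rw [cutExp_le_gapLeft p k (Finset.mem_range.1 hj)]

theorem cutExp_gapRight (p : ℝ) {n : ℕ} (k : Fin n) (F : ℕ → ℝ) :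
    cutExp p Finset.univ (fun C => F (gapRight C k))
      = F 0 + ∑ j ∈ Finset.range (n - 1 - k.val), (F (j + 1) - F j) * (1 - p) ^ (j + 1) := by
  rw [cutExp_eq_of_tail p _ F (fun C => gapRight_le C k)]
  congr 1
  refine Finset.sum_congr rfl fun j hj => ?_
  have := Finset.mem_range.1 hj
  rw [cutExp_le_gapRight p k (by omega)]

theorem cutExp_gapLeft_mul_gapRight (p : ℝ) {n : ℕ} (k : Fin n) :
    cutExp p Finset.univ (fun C => (gapLeft C k : ℝ) * gapRight C k)
      = (∑ j ∈ Finset.range k.val, (1 - p) ^ (j + 1))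
        * ∑ j ∈ Finset.range (n - 1 - k.val), (1 - p) ^ (j + 1) := by
  have h : ∀ C : Finset (Fin (n - 1)), (gapLeft C k : ℝ) * gapRight C k
      = ∑ i ∈ Finset.range k.val, ∑ j ∈ Finset.range (n - 1 - k.val),
        (if i + 1 ≤ gapLeft C k then (1 : ℝ) else 0) *
          (if j + 1 ≤ gapRight C k then 1 else 0) := by
    intro C
    rw [← Finset.sum_mul_sum, eq_add_sum_tail (fun m => (m : ℝ)) (gapLeft_le C k),
      eq_add_sum_tail (fun m => (m : ℝ)) (gapRight_le C k)]
    simp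
  simp only [h]
  rw [cutExp_sum, Finset.sum_mul_sum]
  refine Finset.sum_congr rfl fun i hi => ?_
  rw [cutExp_sum]
  refine Finset.sum_congr rfl fun j hj => ?_
  have := Finset.mem_range.1 hj
  rw [cutExp_le_gapLeft_mul_le_gapRight p k (Finset.mem_range.1 hi) (by omega), ← pow_add]

theorem sum_geom_succ {p : ℝ} (hp : p ≠ 0) (N : ℕ) :
    ∑ j ∈ Finset.range N, (1 - p) ^ (j + 1) = (1 - p) * (1 - (1 - p) ^ N) / p := by
  induction N with
  | zero => simp
  | succ N ih =>
    rw [Finset.sum_range_succ, ih]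
    field_simp
    ring

theorem sum_odd_geom_succ {p : ℝ} (hp : p ≠ 0) (N : ℕ) :
    ∑ j ∈ Finset.range N, (2 * (j : ℝ) + 1) * (1 - p) ^ (j + 1)
      = ((1 - p) * (2 - p) - (1 - p) ^ (N + 1) * (2 * N + 1 - (2 * N - 1) * (1 - p))) / p ^ 2 := by
  induction N with
  | zero => simp; ring
  | succ N ih =>
    rw [Finset.sum_range_succ, ih]
    field_simp
    push_cast
    ring

theorem cutExp_displacement {p : ℝ} (hp : p ≠ 0) {n : ℕ} (k : Fin n) :
    cutExp p Finset.univ (fun C => (gapRight C k : ℝ) - gapLeft C k)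
      = (1 - p) * ((1 - p) ^ k.val - (1 - p) ^ (n - 1 - k.val)) / p := by
  rw [cutExp_sub, cutExp_gapRight p k (fun m => (m : ℝ)), cutExp_gapLeft p k (fun m => (m : ℝ))]
  simp only [Nat.cast_add, Nat.cast_one, add_sub_cancel_left, one_mul, sum_geom_succ hp]
  push_cast
  ring

theorem cutExp_displacement_sq {p : ℝ} (hp : p ≠ 0) {n : ℕ} (k : Fin n) :
    cutExp p Finset.univ (fun C => ((gapRight C k : ℝ) - gapLeft C k) ^ 2)
      = (∑ j ∈ Finset.range (n - 1 - k.val), (2 * (j : ℝ) + 1) * (1 - p) ^ (j + 1))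
        + (∑ j ∈ Finset.range k.val, (2 * (j : ℝ) + 1) * (1 - p) ^ (j + 1))
        - 2 * (((1 - p) * (1 - (1 - p) ^ k.val) / p)
          * ((1 - p) * (1 - (1 - p) ^ (n - 1 - k.val)) / p)) := by
  have h : ∀ C : Finset (Fin (n - 1)), ((gapRight C k : ℝ) - gapLeft C k) ^ 2
      = (gapRight C k : ℝ) ^ 2 + (gapLeft C k : ℝ) ^ 2
        - 2 * ((gapLeft C k : ℝ) * gapRight C k) := fun C => by ring
  simp only [h]
  rw [cutExp_sub, cutExp_add, cutExp_const_mul, cutExp_gapLeft_mul_gapRight,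
    cutExp_gapRight p k (fun m => (m : ℝ) ^ 2), cutExp_gapLeft p k (fun m => (m : ℝ) ^ 2),
    sum_geom_succ hp, sum_geom_succ hp]
  have e : ∀ j : ℕ, ((j + 1 : ℕ) : ℝ) ^ 2 - (j : ℝ) ^ 2 = 2 * j + 1 := fun j => by
    push_cast
    ring
  simp only [e]
  simp

theorem abs_cutExp_displacement_le {p : ℝ} (hp0 : 0 < p) (hp1 : p < 1) {n : ℕ} (k : Fin n) :
    |cutExp p Finset.univ (fun C => (gapRight C k : ℝ) - gapLeft C k)|
      ≤ ((1 - p) ^ k.val + (1 - p) ^ (n - 1 - k.val)) / p := by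
  rw [cutExp_displacement hp0.ne', abs_div, abs_of_pos hp0]
  gcongr
  have hq : 0 < 1 - p := by linarith
  have h1 : 0 ≤ (1 - p) ^ k.val := by positivity
  have h2 : 0 ≤ (1 - p) ^ (n - 1 - k.val) := by positivity
  rw [abs_mul, abs_of_pos hq]
  have h3 : |(1 - p) ^ k.val - (1 - p) ^ (n - 1 - k.val)|
      ≤ (1 - p) ^ k.val + (1 - p) ^ (n - 1 - k.val) := by
    rw [abs_le]
    constructor <;> linarith
  nlinarith [abs_nonneg ((1 - p) ^ k.val - (1 - p) ^ (n - 1 - k.val))]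

theorem abs_sum_odd_geom_succ_sub_le {p : ℝ} (hp0 : 0 < p) (hp1 : p < 1) (N : ℕ) :
    |(∑ j ∈ Finset.range N, (2 * (j : ℝ) + 1) * (1 - p) ^ (j + 1)) - (1 - p) * (2 - p) / p ^ 2|
      ≤ 2 * (N + 1) * (1 - p) ^ N / p ^ 2 := by
  have hq : 0 < 1 - p := by linarith
  rw [sum_odd_geom_succ hp0.ne', ← sub_div, sub_sub_cancel_left, abs_div, abs_neg,
    abs_of_pos (by positivity : 0 < p ^ 2)]
  have hN : (0 : ℝ) ≤ N := N.cast_nonneg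
  have h : 0 ≤ 2 * (N : ℝ) + 1 - (2 * N - 1) * (1 - p) := by nlinarith
  rw [abs_of_nonneg (by positivity)]
  gcongr ?_ / _
  rw [pow_succ]
  have h2 : (1 - p) * (2 * (N : ℝ) + 1 - (2 * N - 1) * (1 - p)) ≤ 2 * (N + 1) := by nlinarith
  calc _ = (1 - p) ^ N * ((1 - p) * (2 * (N : ℝ) + 1 - (2 * N - 1) * (1 - p))) := by ring
    _ ≤ (1 - p) ^ N * (2 * (N + 1)) := by gcongr
    _ = _ := by ring

/-- For untruncated independent geometric gaps the value is twice the variance (1-p)/p². The error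
comes from truncation at the ends of the deck and decays geometrically with the distance to them. -/
theorem abs_cutExp_displacement_sq_sub_le {p : ℝ} (hp0 : 0 < p) (hp1 : p < 1) {n : ℕ}
    (k : Fin n) :
    |cutExp p Finset.univ (fun C => ((gapRight C k : ℝ) - gapLeft C k) ^ 2)
        - 2 * (1 - p) / p ^ 2|
      ≤ 4 * ((k.val + 1) * (1 - p) ^ k.val
        + ((n - 1 - k.val : ℕ) + 1) * (1 - p) ^ (n - 1 - k.val)) / p ^ 2 := by
  rw [cutExp_displacement_sq hp0.ne']
  set b := n - 1 - k.val
  set a := k.val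
  have ha := abs_sum_odd_geom_succ_sub_le hp0 hp1 a
  have hb := abs_sum_odd_geom_succ_sub_le hp0 hp1 b
  set Ta := ∑ j ∈ Finset.range a, (2 * (j : ℝ) + 1) * (1 - p) ^ (j + 1)
  set Tb := ∑ j ∈ Finset.range b, (2 * (j : ℝ) + 1) * (1 - p) ^ (j + 1)
  have hq : 0 < 1 - p := by linarith
  have hx0 : 0 ≤ (1 - p) ^ a := by positivity
  have hx1 : (1 - p) ^ a ≤ 1 := pow_le_one₀ hq.le (by linarith)
  have hy0 : 0 ≤ (1 - p) ^ b := by positivity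
  have hy1 : (1 - p) ^ b ≤ 1 := pow_le_one₀ hq.le (by linarith)
  set x := (1 - p) ^ a
  set y := (1 - p) ^ b
  have hc : |2 * (1 - p) ^ 2 * (x + y - x * y) / p ^ 2| ≤ 2 * (x + y) / p ^ 2 := by
    have h0 : 0 ≤ x + y - x * y := by nlinarith
    rw [abs_of_nonneg (by positivity)]
    gcongr ?_ / _
    have : (1 - p) ^ 2 ≤ 1 := pow_le_one₀ hq.le (by linarith)
    nlinarith [mul_nonneg hx0 hy0]
  have e : Tb + Ta - 2 * (((1 - p) * (1 - x) / p) * ((1 - p) * (1 - y) / p))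
      - 2 * (1 - p) / p ^ 2
      = (Ta - (1 - p) * (2 - p) / p ^ 2) + (Tb - (1 - p) * (2 - p) / p ^ 2)
        + 2 * (1 - p) ^ 2 * (x + y - x * y) / p ^ 2 := by
    field_simp
    ring
  rw [e]
  refine (abs_add_three _ _ _).trans ((add_le_add (add_le_add ha hb) hc).trans ?_)
  rw [← add_div, ← add_div]
  gcongr ?_ / _
  nlinarith [mul_nonneg (a.cast_nonneg (α := ℝ)) hx0, mul_nonneg (b.cast_nonneg (α := ℝ)) hy0]

/-- An upper bound for the fourth moments of the gaps. -/
noncomputable def fourthMomentBound (p : ℝ) : ℝ := ∑' j : ℕ, ((j : ℝ) + 1) ^ 4 * (1 - p) ^ j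

theorem summable_succ_pow_mul_geom {p : ℝ} (hp0 : 0 < p) (hp1 : p < 1) (m : ℕ) :
    Summable fun j : ℕ => ((j : ℝ) + 1) ^ m * (1 - p) ^ j := by
  have hq : 0 < 1 - p := by linarith
  have h := summable_pow_mul_geometric_of_norm_lt_one (R := ℝ) m (r := 1 - p)
    (by rw [Real.norm_eq_abs, abs_of_pos hq]; linarith)
  have h2 := ((summable_nat_add_iff 1).2 h).mul_right (1 - p)⁻¹
  refine h2.congr fun j => ?_
  rw [pow_succ]
  push_cast
  field_simp

/-- The assumed tail bound has exponent j, not j + 1: the spare factor leaves room for one slot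
being forced uncut, as in the Efron–Stein differences. -/
theorem cutExp_pow_four_le {p : ℝ} (hp0 : 0 < p) (hp1 : p < 1) {α : Type*} [DecidableEq α]
    (S : Finset α) {X : Finset α → ℕ} {N : ℕ} (hX : ∀ C, X C ≤ N)
    (h : ∀ j < N, cutExp p S (fun C => if j + 1 ≤ X C then 1 else 0) ≤ (1 - p) ^ j) :
    cutExp p S (fun C => (X C : ℝ) ^ 4) ≤ fourthMomentBound p := by
  have hq : 0 < 1 - p := by linarith
  rw [cutExp_eq_of_tail p S (fun m => (m : ℝ) ^ 4) hX]
  refine le_trans ?_ ((summable_succ_pow_mul_geom hp0 hp1 4).sum_le_tsum (Finset.range N)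
    fun j _ => by positivity)
  simp only [Nat.cast_zero, ne_eq, OfNat.ofNat_ne_zero, not_false_eq_true, zero_pow, zero_add]
  refine Finset.sum_le_sum fun j hj => ?_
  have hj0 : (0 : ℝ) ≤ j := j.cast_nonneg
  have h1 : 0 ≤ ((j + 1 : ℕ) : ℝ) ^ 4 - (j : ℝ) ^ 4 := by
    push_cast
    have : (j : ℝ) ^ 4 ≤ ((j : ℝ) + 1) ^ 4 := by gcongr; linarith
    linarith
  calc _ ≤ (((j + 1 : ℕ) : ℝ) ^ 4 - (j : ℝ) ^ 4) * (1 - p) ^ j := by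
        gcongr
        exact h j (Finset.mem_range.1 hj)
    _ ≤ _ := by
        gcongr
        push_cast
        have : 0 ≤ (j : ℝ) ^ 4 := by positivity
        linarith

theorem cutExp_gapLeft_pow_four_le {p : ℝ} (hp0 : 0 < p) (hp1 : p < 1) {n : ℕ} (k : Fin n) :
    cutExp p Finset.univ (fun C => (gapLeft C k : ℝ) ^ 4) ≤ fourthMomentBound p :=
  cutExp_pow_four_le hp0 hp1 _ (fun C => gapLeft_le C k) fun j hj => by
    rw [cutExp_le_gapLeft p k hj]
    exact pow_le_pow_of_le_one (by linarith) (by linarith) (Nat.le_succ j)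

theorem cutExp_gapRight_pow_four_le {p : ℝ} (hp0 : 0 < p) (hp1 : p < 1) {n : ℕ} (k : Fin n) :
    cutExp p Finset.univ (fun C => (gapRight C k : ℝ) ^ 4) ≤ fourthMomentBound p :=
  cutExp_pow_four_le hp0 hp1 _ (fun C => gapRight_le C k) fun j hj => by
    rw [cutExp_le_gapRight p k (by omega)]
    exact pow_le_pow_of_le_one (by linarith) (by linarith) (Nat.le_succ j)

theorem disjoint_erase_right_iff {α : Type*} [DecidableEq α] (A C : Finset α) (s : α) :
    Disjoint A (C.erase s) ↔ Disjoint (A.erase s) C := by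
  rw [Finset.disjoint_right, Finset.disjoint_right]
  simp only [Finset.mem_erase]
  tauto

theorem cutExp_uncut_erase_le {p : ℝ} (hp0 : 0 < p) (hp1 : p < 1) {α : Type*} [DecidableEq α]
    {S A : Finset α} (hA : A ⊆ S) (s : α) :
    cutExp p S (fun C => if Disjoint A (C.erase s) then 1 else 0) ≤ (1 - p) ^ (A.card - 1) := by
  simp only [disjoint_erase_right_iff]
  rw [cutExp_uncut p ((Finset.erase_subset _ _).trans hA)]
  exact pow_le_pow_of_le_one (by linarith) (by linarith) Finset.pred_card_le_card_erase

theorem cutExp_gapLeft_erase_pow_four_le {p : ℝ} (hp0 : 0 < p) (hp1 : p < 1) {n : ℕ}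
    (k : Fin n) (s : Fin (n - 1)) :
    cutExp p Finset.univ (fun C => (gapLeft (C.erase s) k : ℝ) ^ 4) ≤ fourthMomentBound p :=
  cutExp_pow_four_le hp0 hp1 _ (fun C => gapLeft_le (C.erase s) k) fun j hj => by
    simp only [le_gapLeft_iff (Finset.erase _ s) k (Nat.succ_le_of_lt hj)]
    refine (cutExp_uncut_erase_le hp0 hp1 (Finset.subset_univ _) s).trans_eq ?_
    rw [card_slots (by omega)]
    congr 1
    omega

theorem cutExp_gapRight_erase_pow_four_le {p : ℝ} (hp0 : 0 < p) (hp1 : p < 1) {n : ℕ}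
    (k : Fin n) (s : Fin (n - 1)) :
    cutExp p Finset.univ (fun C => (gapRight (C.erase s) k : ℝ) ^ 4) ≤ fourthMomentBound p :=
  cutExp_pow_four_le hp0 hp1 _ (fun C => gapRight_le (C.erase s) k) fun j hj => by
    simp only [le_gapRight_iff (j := j + 1) (Finset.erase _ s) k (by omega)]
    refine (cutExp_uncut_erase_le hp0 hp1 (Finset.subset_univ _) s).trans_eq ?_
    rw [card_slots (by omega)]
    congr 1
    omega

end Moments

/-! ### Drift of the cosine statistic in one shuffle. -/

section Drift

/-- No smallness of d is assumed, since displacements can be comparable to the deck. For |d| > 1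
every term is bounded crudely, in total by 3.5|d|³. -/
theorem abs_cos_add_sub_taylor_le (a d : ℝ) :
    |Real.cos (a + d) - (Real.cos a - d * Real.sin a - d ^ 2 / 2 * Real.cos a)|
      ≤ 4 * |d| ^ 3 := by
  have hc := Real.abs_cos_le_one a
  have hs := Real.abs_sin_le_one a
  have hd := abs_nonneg d
  have e : Real.cos (a + d) - (Real.cos a - d * Real.sin a - d ^ 2 / 2 * Real.cos a)
      = Real.cos a * (Real.cos d - (1 - d ^ 2 / 2))
        - Real.sin a * (Real.sin d - d) := by
    rw [Real.cos_add]
    ring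
  have key : |Real.cos (a + d) - (Real.cos a - d * Real.sin a - d ^ 2 / 2 * Real.cos a)|
      ≤ |Real.cos d - (1 - d ^ 2 / 2)| + |Real.sin d - d| := by
    rw [e]
    refine (abs_sub _ _).trans ?_
    rw [abs_mul, abs_mul]
    exact add_le_add (mul_le_of_le_one_left (abs_nonneg _) hc)
      (mul_le_of_le_one_left (abs_nonneg _) hs)
  refine key.trans ?_
  rcases le_or_gt |d| 1 with h | h
  · have h1 := Real.cos_bound h
    have h2 : |Real.sin d - d| ≤ |d| ^ 5 / 100 + |d| ^ 3 / 6 := by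
      have e2 : Real.sin d - d = (Real.sin d - (d - d ^ 3 / 6)) + (-(d ^ 3 / 6)) := by ring
      rw [e2]
      refine (abs_add_le _ _).trans (add_le_add (Real.sin_bound h) ?_)
      rw [abs_neg, abs_div, abs_pow, abs_of_pos (by norm_num : (0 : ℝ) < 6)]
    have h4 : |d| ^ 4 ≤ |d| ^ 3 := pow_le_pow_of_le_one hd h (by norm_num)
    have h5 : |d| ^ 5 ≤ |d| ^ 3 := pow_le_pow_of_le_one hd h (by norm_num)
    have h3 : 0 ≤ |d| ^ 3 := by positivity
    linarith
  · have h2 : |Real.sin d - d| ≤ 1 + |d| :=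
      (abs_sub _ _).trans (add_le_add (Real.abs_sin_le_one d) le_rfl)
    have h3 : |d| ≤ |d| ^ 3 := le_self_pow₀ h.le (by norm_num)
    have h4 : |d| ^ 2 ≤ |d| ^ 3 := pow_le_pow_right₀ h.le (by norm_num)
    have h7 : |Real.cos d - (1 - d ^ 2 / 2)| ≤ |d| ^ 2 / 2 + |1 - Real.cos d| := by
      have e3 : Real.cos d - (1 - d ^ 2 / 2) = d ^ 2 / 2 - (1 - Real.cos d) := by ring
      rw [e3]
      refine (abs_sub _ _).trans ?_
      rw [abs_of_nonneg (by positivity : 0 ≤ d ^ 2 / 2), sq_abs]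
    have h8 : |1 - Real.cos d| ≤ |d| := by
      have := Real.abs_cos_sub_cos_le 0 d
      simpa using this
    linarith

theorem abs_cutExp_sub_le {α : Type*} {p : ℝ} (hp0 : 0 ≤ p) (hp1 : p ≤ 1) (S : Finset α)
    {f g h : Finset α → ℝ} (hfg : ∀ C, |f C - g C| ≤ h C) :
    |cutExp p S f - cutExp p S g| ≤ cutExp p S h := by
  rw [← cutExp_sub, abs_le]
  constructor
  · have := cutExp_mono hp0 hp1 S (f := fun C => (-1) * h C) (g := fun C => f C - g C)
      fun C => by have := (abs_le.1 (hfg C)).1; linarith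
    rw [cutExp_const_mul] at this
    linarith
  · exact cutExp_mono hp0 hp1 S fun C => (abs_le.1 (hfg C)).2

theorem cutExp_abs_displacement_cube_le {p : ℝ} (hp0 : 0 < p) (hp1 : p < 1) {n : ℕ}
    (k : Fin n) :
    cutExp p Finset.univ (fun C => |(gapRight C k : ℝ) - gapLeft C k| ^ 3)
      ≤ 16 * fourthMomentBound p := by
  have h : ∀ C : Finset (Fin (n - 1)), |(gapRight C k : ℝ) - gapLeft C k| ^ 3
      ≤ 8 * ((gapRight C k : ℝ) ^ 4 + (gapLeft C k : ℝ) ^ 4) := by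
    intro C
    have h1 : |(gapRight C k : ℝ) - gapLeft C k| ≤ gapRight C k + gapLeft C k := by
      refine (abs_sub _ _).trans_eq ?_
      rw [Nat.abs_cast, Nat.abs_cast]
    -- Gaps are natural numbers, so a cube is at most a fourth power and the fourth moment suffices.
    have h2 : ((gapRight C k : ℝ) + gapLeft C k) ^ 3
        ≤ ((gapRight C k : ℝ) + gapLeft C k) ^ 4 := by
      rcases Nat.eq_zero_or_pos (gapRight C k + gapLeft C k) with h0 | h0
      · have h0' : (gapRight C k : ℝ) + gapLeft C k = 0 := by exact_mod_cast h0
        simp [h0']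
      · exact pow_le_pow_right₀ (by exact_mod_cast h0) (by norm_num)
    have h3 := add_pow_le (gapRight C k).cast_nonneg (gapLeft C k).cast_nonneg 4 (R := ℝ)
    norm_num at h3
    calc _ ≤ ((gapRight C k : ℝ) + gapLeft C k) ^ 3 := by gcongr
      _ ≤ _ := h2.trans h3
  refine (cutExp_mono hp0.le hp1.le _ h).trans ?_
  rw [cutExp_const_mul, cutExp_add]
  linarith [cutExp_gapLeft_pow_four_le hp0 hp1 k, cutExp_gapRight_pow_four_le hp0 hp1 k]

theorem abs_sin_pi_div_mul_le {n : ℕ} (k : Fin n) :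
    |Real.sin (Real.pi / n * k.val)| ≤ Real.pi / n * k.val ∧
    |Real.sin (Real.pi / n * k.val)| ≤ Real.pi / n * ((n - 1 - k.val : ℕ) + 1) := by
  have hn : (0 : ℝ) < n := by exact_mod_cast k.pos
  have hpi := Real.pi_pos
  constructor
  · refine Real.abs_sin_le_abs.trans_eq (abs_of_nonneg (by positivity))
  · have e : Real.pi / n * ((n - 1 - k.val : ℕ) + 1) = Real.pi - Real.pi / n * k.val := by
      have h : (((n - 1 - k.val : ℕ) : ℝ) + 1) = n - k.val := by
        have := k.isLt
        have h2 : ((n - 1 - k.val) + 1) + k.val = n := by omega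
        rw [eq_sub_iff_add_eq]
        exact_mod_cast h2
      rw [h]
      field_simp
    rw [← Real.sin_pi_sub, ← e]
    exact Real.abs_sin_le_abs.trans_eq (abs_of_nonneg (by positivity))

/-- `cos (π k / n)` is nearly an eigenfunction of the motion of a single card, the error being
concentrated near the two ends of the deck. -/
theorem abs_cutExp_cos_sub_le {p : ℝ} (hp0 : 0 < p) (hp1 : p < 1) {n : ℕ} (k : Fin n) :
    |cutExp p Finset.univ (fun C => Real.cos (Real.pi / n * (reversePackets C k).val))
        - (1 - (Real.pi / n) ^ 2 * ((1 - p) / p ^ 2)) * Real.cos (Real.pi / n * k.val)|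
      ≤ (Real.pi / n) ^ 2 * (3 / p ^ 2) * ((k.val + 1) * (1 - p) ^ k.val
        + ((n - 1 - k.val : ℕ) + 1) * (1 - p) ^ (n - 1 - k.val))
        + 64 * (Real.pi / n) ^ 3 * fourthMomentBound p := by
  have hn : (0 : ℝ) < n := by exact_mod_cast k.pos
  have hθ : 0 < Real.pi / n := div_pos Real.pi_pos hn
  have hq : 0 < 1 - p := by linarith
  obtain ⟨hs1, hs2⟩ := abs_sin_pi_div_mul_le k
  have hm1 := abs_cutExp_displacement_le hp0 hp1 k
  have hm2 := abs_cutExp_displacement_sq_sub_le hp0 hp1 k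
  have hm3 := cutExp_abs_displacement_cube_le hp0 hp1 k
  have hcos := Real.abs_cos_le_one (Real.pi / n * k.val)
  set θ := Real.pi / n
  set m1 := cutExp p Finset.univ (fun C => (gapRight C k : ℝ) - gapLeft C k) with hm1d
  set m2 := cutExp p Finset.univ (fun C => ((gapRight C k : ℝ) - gapLeft C k) ^ 2) with hm2d
  have ht : |cutExp p Finset.univ (fun C => Real.cos (θ * (reversePackets C k).val))
      - (Real.cos (θ * k.val) - θ * Real.sin (θ * k.val) * m1
        - θ ^ 2 / 2 * Real.cos (θ * k.val) * m2)| ≤ 64 * θ ^ 3 * fourthMomentBound p := by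
    have h := abs_cutExp_sub_le hp0.le hp1.le (Finset.univ : Finset (Fin (n - 1)))
      (f := fun C => Real.cos (θ * (reversePackets C k).val))
      (g := fun C => Real.cos (θ * k.val)
        - θ * Real.sin (θ * k.val) * ((gapRight C k : ℝ) - gapLeft C k)
        - θ ^ 2 / 2 * Real.cos (θ * k.val) * ((gapRight C k : ℝ) - gapLeft C k) ^ 2)
      (h := fun C => 4 * θ ^ 3 * |(gapRight C k : ℝ) - gapLeft C k| ^ 3) fun C => by
        have := abs_cos_add_sub_taylor_le (θ * k.val)
          (θ * ((gapRight C k : ℝ) - gapLeft C k))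
        rw [abs_mul, abs_of_pos hθ, mul_pow] at this
        rw [reversePackets_val, mul_add]
        refine le_trans (le_of_eq ?_) (this.trans (le_of_eq (by ring)))
        congr 1
        ring
    rw [cutExp_sub, cutExp_sub, cutExp_const, cutExp_const_mul, cutExp_const_mul,
      cutExp_const_mul, ← hm1d, ← hm2d] at h
    refine h.trans ?_
    have : 0 < θ ^ 3 := by positivity
    nlinarith
  set a : ℝ := (k.val : ℝ)
  set b : ℝ := ((n - 1 - k.val : ℕ) : ℝ)
  have ha : 0 ≤ a := Nat.cast_nonneg _
  have hb : 0 ≤ b := Nat.cast_nonneg _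
  have hx : 0 < (1 - p) ^ k.val := by positivity
  have hy : 0 < (1 - p) ^ (n - 1 - k.val) := by positivity
  set x := (1 - p) ^ k.val
  set y := (1 - p) ^ (n - 1 - k.val)
  -- The drift m1 is of order one near the ends, but there the sine is at most θ times the distance
  -- to the end (plus one), which supplies the second factor θ.
  have b1 : |θ * Real.sin (θ * a) * m1| ≤ θ ^ 2 * (1 / p ^ 2) * ((a + 1) * x + (b + 1) * y) := by
    rw [abs_mul, abs_mul, abs_of_pos hθ]
    have hp' : 1 / p ≤ 1 / p ^ 2 := by
      apply one_div_le_one_div_of_le (by positivity)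
      nlinarith
    have h1 : |Real.sin (θ * a)| * (x + y) ≤ θ * ((a + 1) * x + (b + 1) * y) := by
      have h2 := mul_le_mul_of_nonneg_right hs1 hx.le
      have h3 := mul_le_mul_of_nonneg_right hs2 hy.le
      have h4 := mul_pos hθ hx
      linarith
    calc θ * |Real.sin (θ * a)| * |m1| ≤ θ * |Real.sin (θ * a)| * ((x + y) / p) := by gcongr
      _ = θ * (1 / p) * (|Real.sin (θ * a)| * (x + y)) := by ring
      _ ≤ θ * (1 / p ^ 2) * (θ * ((a + 1) * x + (b + 1) * y)) := by gcongr
      _ = _ := by ring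
  have b2 : |θ ^ 2 / 2 * Real.cos (θ * a) * (m2 - 2 * (1 - p) / p ^ 2)|
      ≤ θ ^ 2 * (2 / p ^ 2) * ((a + 1) * x + (b + 1) * y) := by
    rw [abs_mul, abs_mul, abs_of_pos (by positivity : 0 < θ ^ 2 / 2)]
    calc _ ≤ θ ^ 2 / 2 * 1 * (4 * ((a + 1) * x + (b + 1) * y) / p ^ 2) := by gcongr
      _ = _ := by ring
  set Z := cutExp p Finset.univ (fun C => Real.cos (θ * (reversePackets C k).val))
  have e : Z - (1 - θ ^ 2 * ((1 - p) / p ^ 2)) * Real.cos (θ * a)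
      = (Z - (Real.cos (θ * a) - θ * Real.sin (θ * a) * m1 - θ ^ 2 / 2 * Real.cos (θ * a) * m2))
        + (-(θ * Real.sin (θ * a) * m1))
        + (-(θ ^ 2 / 2 * Real.cos (θ * a) * (m2 - 2 * (1 - p) / p ^ 2))) := by
    ring
  rw [e]
  refine (abs_add_three _ _ _).trans ?_
  rw [abs_neg, abs_neg]
  have e2 : θ ^ 2 * (3 / p ^ 2) * ((a + 1) * x + (b + 1) * y)
      = θ ^ 2 * (1 / p ^ 2) * ((a + 1) * x + (b + 1) * y)
        + θ ^ 2 * (2 / p ^ 2) * ((a + 1) * x + (b + 1) * y) := by ring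
  rw [e2]
  linarith

theorem sum_range_succ_mul_geom_le {p : ℝ} (hp0 : 0 < p) (hp1 : p < 1) (n : ℕ) :
    ∑ j ∈ Finset.range n, ((j : ℝ) + 1) * (1 - p) ^ j ≤ fourthMomentBound p := by
  have hq : 0 < 1 - p := by linarith
  refine le_trans (Finset.sum_le_sum fun j _ => ?_)
    ((summable_succ_pow_mul_geom hp0 hp1 4).sum_le_tsum (Finset.range n)
      fun j _ => by positivity)
  have : (1 : ℝ) ≤ (j : ℝ) + 1 := by linarith [j.cast_nonneg (α := ℝ)]
  gcongr
  exact le_self_pow₀ this (by norm_num)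

/-- Constant in the bound for the failure of the test function to be an eigenfunction. -/
noncomputable def driftConst (p : ℝ) : ℝ := fourthMomentBound p * (6 / p ^ 2 + 64 * Real.pi)

/-- Weighted sum of the cosines of the new positions, after the packets given by `C` have been
reversed; `w k` is the weight of the card that was at position `k`. -/
noncomputable def score {n : ℕ} (w : Fin n → ℝ) (C : Finset (Fin (n - 1))) : ℝ :=
  ∑ k, w k * Real.cos (Real.pi / n * (reversePackets C k).val)

/-- Summed over positions, the boundary errors form a convergent series times θ², and the n Taylor
errors of size θ³ also add up to O(θ²). -/
theorem abs_cutExp_score_sub_le {p : ℝ} (hp0 : 0 < p) (hp1 : p < 1) {n : ℕ} (w : Fin n → ℝ)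
    (hw : ∀ k, |w k| ≤ 1) :
    |cutExp p Finset.univ (score w) - (1 - (Real.pi / n) ^ 2 * ((1 - p) / p ^ 2)) *
        ∑ k, w k * Real.cos (Real.pi / n * k.val)|
      ≤ driftConst p * (Real.pi / n) ^ 2 := by
  have e : cutExp p Finset.univ (score w) - (1 - (Real.pi / n) ^ 2 * ((1 - p) / p ^ 2)) *
        ∑ k, w k * Real.cos (Real.pi / n * k.val)
      = ∑ k, w k *
        (cutExp p Finset.univ (fun C => Real.cos (Real.pi / n * (reversePackets C k).val))
        - (1 - (Real.pi / n) ^ 2 * ((1 - p) / p ^ 2)) * Real.cos (Real.pi / n * k.val)) := by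
    have : (score w) = fun C : Finset (Fin (n - 1)) =>
      ∑ k, w k * Real.cos (Real.pi / n * (reversePackets C k).val) := rfl
    rw [this, cutExp_sum, Finset.mul_sum, ← Finset.sum_sub_distrib]
    refine Finset.sum_congr rfl fun k _ => ?_
    rw [cutExp_const_mul]
    ring
  rw [e]
  refine (Finset.abs_sum_le_sum_abs _ _).trans ?_
  refine (Finset.sum_le_sum fun k _ => (abs_mul _ _).trans_le <|
    (mul_le_of_le_one_left (abs_nonneg _) (hw k)).trans (abs_cutExp_cos_sub_le hp0 hp1 k)).trans ?_
  rw [Finset.sum_add_distrib, ← Finset.mul_sum, Finset.sum_add_distrib,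
    Fin.sum_univ_eq_sum_range (fun k => ((k : ℝ) + 1) * (1 - p) ^ k) n,
    Fin.sum_univ_eq_sum_range
      (fun k => (((n - 1 - k : ℕ) : ℝ) + 1) * (1 - p) ^ (n - 1 - k)) n,
    Finset.sum_range_reflect (fun k => ((k : ℝ) + 1) * (1 - p) ^ k) n]
  have hS := sum_range_succ_mul_geom_le hp0 hp1 n
  set T := ∑ j ∈ Finset.range n, ((j : ℝ) + 1) * (1 - p) ^ j
  rcases Nat.eq_zero_or_pos n with hn | hn
  · subst hn
    simp
  have hn' : (0 : ℝ) < n := by exact_mod_cast hn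
  rw [Finset.sum_const, Finset.card_univ, Fintype.card_fin, nsmul_eq_mul, driftConst]
  have e3 : (n : ℝ) * (64 * (Real.pi / n) ^ 3 * fourthMomentBound p)
      = 64 * Real.pi * (Real.pi / n) ^ 2 * fourthMomentBound p := by
    field_simp
  rw [e3]
  calc _ ≤ (Real.pi / n) ^ 2 * (3 / p ^ 2) * (fourthMomentBound p + fourthMomentBound p)
        + 64 * Real.pi * (Real.pi / n) ^ 2 * fourthMomentBound p := by gcongr
    _ = _ := by ring

end Drift

/-! ### One-step variance of the statistic. -/

section Fluctuation

theorem SamePacket.symm {n : ℕ} {C : Finset (Fin (n - 1))} {i j : Fin n}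
    (h : SamePacket C i j) : SamePacket C j i := fun s hs => (h s hs).symm

theorem SamePacket.trans {n : ℕ} {C : Finset (Fin (n - 1))} {i j k : Fin n}
    (h : SamePacket C i j) (h' : SamePacket C j k) : SamePacket C i k :=
  fun s hs => (h s hs).trans (h' s hs)

theorem samePacket_reversePackets {n : ℕ} (C : Finset (Fin (n - 1))) (k : Fin n) :
    SamePacket C k (reversePackets C k) := by
  rw [← mem_packet]
  change reverseFun C k ∈ packet C k
  rw [← packet_reverseFun]
  exact self_mem_packet C _

/-- The position just above a slot. -/
def slotPos {n : ℕ} (s : Fin (n - 1)) : Fin n := ⟨s.val, by omega⟩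

/-- Toggling slot s only splits or merges the packet that straddles s when s is uncut; all other
packets are unchanged. -/
theorem reversePackets_insert_eq {n : ℕ} (C : Finset (Fin (n - 1))) (s : Fin (n - 1))
    (k : Fin n) (hk : k ∉ packet (C.erase s) (slotPos s)) :
    reversePackets (insert s C) k = reversePackets (C.erase s) k := by
  have h : packet (insert s C) k = packet (C.erase s) k := by
    ext j
    rw [mem_packet, mem_packet]
    constructor
    · intro h r hr
      exact h r (Finset.mem_insert_of_mem (Finset.mem_of_mem_erase hr))
    · intro h r hr
      by_cases hrs : r = s
      · subst hrs
        by_contra hne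
        refine hk (mem_packet.2 fun t ht => ?_)
        have h1 := h t ht
        have h2 : t.val ≠ r.val := fun h => (Finset.ne_of_mem_erase ht) (Fin.ext h)
        simp only [slotPos]
        omega
      · exact h r (Finset.mem_erase.2 ⟨hrs, Finset.mem_of_mem_insert_of_ne hr hrs⟩)
  apply Fin.ext
  change (packetFirst _ k).val + (packetLast _ k).val - k.val
    = (packetFirst _ k).val + (packetLast _ k).val - k.val
  simp only [packetFirst, packetLast, h]

/-- With or without the cut at s, the image of k stays inside the merged packet, whose length bounds
the difference. -/
theorem abs_reversePackets_insert_sub_le {n : ℕ} (C : Finset (Fin (n - 1))) (s : Fin (n - 1))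
    (k : Fin n) (hk : k ∈ packet (C.erase s) (slotPos s)) :
    |((reversePackets (insert s C) k).val : ℝ) - (reversePackets (C.erase s) k).val|
      ≤ gapLeft (C.erase s) (slotPos s) + gapRight (C.erase s) (slotPos s) := by
  rw [mem_packet] at hk
  have h0 := hk.trans (samePacket_reversePackets (C.erase s) k)
  have h1 : SamePacket (C.erase s) (slotPos s) (reversePackets (insert s C) k) :=
    hk.trans fun r hr => samePacket_reversePackets (insert s C) k r
      (Finset.mem_insert_of_mem (Finset.mem_of_mem_erase hr))
  have a0 := h0.packetFirst_le
  have a1 := h1.packetFirst_le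
  have b0 := h0.le_packetLast
  have b1 := h1.le_packetLast
  have c0 := packetFirst_le (C.erase s) (slotPos s)
  have c1 := le_packetLast (C.erase s) (slotPos s)
  simp only [gapLeft, gapRight]
  rw [Nat.cast_sub c0, Nat.cast_sub c1, abs_le]
  rify at a0 a1 b0 b1
  constructor <;> linarith

theorem card_packet_le {n : ℕ} (C : Finset (Fin (n - 1))) (k : Fin n) :
    (packet C k).card ≤ 1 + gapLeft C k + gapRight C k := by
  have h : packet C k ⊆ Finset.Icc (packetFirst C k) (packetLast C k) := fun j hj =>
    Finset.mem_Icc.2 ⟨Finset.min'_le _ _ hj, Finset.le_max' _ _ hj⟩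
  refine (Finset.card_le_card h).trans ?_
  have c0 := packetFirst_le C k
  have c1 := le_packetLast C k
  rw [Fin.card_Icc, gapLeft, gapRight]
  omega

/-- At most 1 + l + r cards are affected, and each cosine changes by at most θ(l + r). The square of
this bound is why fourth moments are needed. -/
theorem abs_score_insert_sub_erase_le {n : ℕ} (w : Fin n → ℝ) (hw : ∀ k, |w k| ≤ 1)
    (C : Finset (Fin (n - 1))) (s : Fin (n - 1)) :
    |score w (insert s C) - score w (C.erase s)|
      ≤ Real.pi / n * (1 + gapLeft (C.erase s) (slotPos s)
        + gapRight (C.erase s) (slotPos s)) ^ 2 := by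
  have hθ : 0 ≤ Real.pi / n := by positivity
  set P := packet (C.erase s) (slotPos s)
  have hcard : (P.card : ℝ) ≤ 1 + gapLeft (C.erase s) (slotPos s)
      + gapRight (C.erase s) (slotPos s) := by exact_mod_cast card_packet_le _ _
  set l : ℝ := (gapLeft (C.erase s) (slotPos s) : ℝ)
  set r : ℝ := (gapRight (C.erase s) (slotPos s) : ℝ)
  have hl0 : 0 ≤ l := Nat.cast_nonneg _
  have hr0 : 0 ≤ r := Nat.cast_nonneg _
  have h1 : ∀ k, |w k * Real.cos (Real.pi / n * (reversePackets (insert s C) k).val)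
      - w k * Real.cos (Real.pi / n * (reversePackets (C.erase s) k).val)|
      ≤ if k ∈ P then Real.pi / n * (l + r) else 0 := by
    intro k
    split_ifs with hk
    · rw [← mul_sub, abs_mul]
      refine (mul_le_of_le_one_left (abs_nonneg _) (hw k)).trans ?_
      refine (Real.abs_cos_sub_cos_le _ _).trans ?_
      rw [← mul_sub, abs_mul, abs_of_nonneg hθ]
      gcongr
      exact abs_reversePackets_insert_sub_le C s k hk
    · rw [reversePackets_insert_eq C s k hk]
      simp
  rw [score, score, ← Finset.sum_sub_distrib]
  refine (Finset.abs_sum_le_sum_abs _ _).trans ((Finset.sum_le_sum fun k _ => h1 k).trans ?_)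
  rw [Finset.sum_ite_mem, Finset.univ_inter, Finset.sum_const, nsmul_eq_mul]
  calc (P.card : ℝ) * (Real.pi / n * (l + r))
      ≤ (1 + l + r) * (Real.pi / n * (1 + l + r)) := by
        gcongr
        linarith
    _ = _ := by ring

/-- Constant in the bound for the conditional variance of the test function. -/
noncomputable def varConst (p : ℝ) : ℝ := Real.pi * (8 + 128 * fourthMomentBound p)

theorem fourthMomentBound_nonneg {p : ℝ} (hp1 : p < 1) : 0 ≤ fourthMomentBound p := by
  have hq : 0 < 1 - p := by linarith
  exact tsum_nonneg fun j => by positivity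

theorem cutExp_score_variance_le {p : ℝ} (hp0 : 0 < p) (hp1 : p < 1) {n : ℕ} (w : Fin n → ℝ)
    (hw : ∀ k, |w k| ≤ 1) :
    cutExp p Finset.univ (fun C => score w C ^ 2) - cutExp p Finset.univ (score w) ^ 2
      ≤ varConst p * (Real.pi / n) := by
  have hM := fourthMomentBound_nonneg hp1
  have hs : ∀ s : Fin (n - 1), cutExp p Finset.univ
      (fun C => (score w (insert s C) - score w (C.erase s)) ^ 2)
      ≤ (Real.pi / n) ^ 2 * (8 + 128 * fourthMomentBound p) := by
    intro s
    have h : ∀ C : Finset (Fin (n - 1)), (score w (insert s C) - score w (C.erase s)) ^ 2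
        ≤ (Real.pi / n) ^ 2 * (8 + 64 * ((gapLeft (C.erase s) (slotPos s) : ℝ) ^ 4
          + (gapRight (C.erase s) (slotPos s) : ℝ) ^ 4)) := by
      intro C
      have h1 := abs_score_insert_sub_erase_le w hw C s
      set l : ℝ := (gapLeft (C.erase s) (slotPos s) : ℝ)
      set r : ℝ := (gapRight (C.erase s) (slotPos s) : ℝ)
      have hl0 : 0 ≤ l := Nat.cast_nonneg _
      have hr0 : 0 ≤ r := Nat.cast_nonneg _
      have h2 := add_pow_le zero_le_one (add_nonneg hl0 hr0) 4
      have h3 := add_pow_le hl0 hr0 4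
      norm_num at h2 h3
      have h4 : (1 + l + r) ^ 4 ≤ 8 + 64 * (l ^ 4 + r ^ 4) := by
        rw [add_assoc]
        linarith
      rw [← sq_abs]
      calc _ ≤ (Real.pi / n * (1 + l + r) ^ 2) ^ 2 := by gcongr
        _ = (Real.pi / n) ^ 2 * (1 + l + r) ^ 4 := by ring
        _ ≤ _ := by gcongr
    refine (cutExp_mono hp0.le hp1.le _ h).trans ?_
    rw [cutExp_const_mul, cutExp_add, cutExp_const, cutExp_const_mul, cutExp_add]
    have h5 := cutExp_gapLeft_erase_pow_four_le hp0 hp1 (slotPos s) s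
    have h6 := cutExp_gapRight_erase_pow_four_le hp0 hp1 (slotPos s) s
    refine mul_le_mul_of_nonneg_left ?_ (sq_nonneg _)
    linarith
  refine (cutExp_variance_le hp0.le hp1.le _ _).trans ?_
  have h1 : ∑ s : Fin (n - 1), cutExp p Finset.univ
      (fun C => (score w (insert s C) - score w (C.erase s)) ^ 2)
      ≤ n * ((Real.pi / n) ^ 2 * (8 + 128 * fourthMomentBound p)) := by
    refine (Finset.sum_le_sum fun s _ => hs s).trans ?_
    rw [Finset.sum_const, Finset.card_univ, Fintype.card_fin, nsmul_eq_mul]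
    gcongr
    exact Nat.sub_le _ _
  have h2 : n * ((Real.pi / n) ^ 2 * (8 + 128 * fourthMomentBound p))
      = varConst p * (Real.pi / n) := by
    rcases Nat.eq_zero_or_pos n with hn | hn
    · subst hn
      simp
    have hn' : (0 : ℝ) < n := by exact_mod_cast hn
    rw [varConst]
    field_simp
  rw [h2] at h1
  have h3 : p * (1 - p) ≤ 1 := by nlinarith
  have h4 : 0 ≤ p * (1 - p) := mul_nonneg hp0.le (by linarith)
  have h5 : 0 ≤ varConst p * (Real.pi / n) := by
    rw [varConst]
    positivity
  calc _ ≤ p * (1 - p) * (varConst p * (Real.pi / n)) := mul_le_mul_of_nonneg_left h1 h4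
    _ ≤ _ := mul_le_of_le_one_left h5 h3

end Fluctuation

/-! ### Wilson's method for approximate eigenfunctions of a finite chain. -/

section Wilson

variable {S : Type*} [Fintype S]

/-- `μ` is the mass function of a probability distribution. -/
def IsProb (μ : S → ℝ) : Prop := (∀ s, 0 ≤ μ s) ∧ ∑ s, μ s = 1

/-- Mean of `f` under `μ`. -/
noncomputable def mean (μ f : S → ℝ) : ℝ := ∑ s, μ s * f s

/-- Variance of `f` under `μ`. -/
noncomputable def variance (μ f : S → ℝ) : ℝ := ∑ s, μ s * (f s - mean μ f) ^ 2

theorem mean_mono {μ : S → ℝ} (hμ : IsProb μ) {f g : S → ℝ} (h : ∀ s, f s ≤ g s) :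
    mean μ f ≤ mean μ g :=
  Finset.sum_le_sum fun s _ => mul_le_mul_of_nonneg_left (h s) (hμ.1 s)

theorem mean_sub_sq {μ : S → ℝ} (hμ : IsProb μ) (f : S → ℝ) (c : ℝ) :
    mean μ (fun s => (f s - c) ^ 2) = variance μ f + (mean μ f - c) ^ 2 := by
  have h : ∀ c, mean μ (fun s => (f s - c) ^ 2)
      = mean μ (fun s => f s ^ 2) - 2 * c * mean μ f + c ^ 2 := by
    intro c
    have e : ∀ s, μ s * (f s - c) ^ 2 = μ s * f s ^ 2 - 2 * c * (μ s * f s) + μ s * c ^ 2 :=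
      fun s => by ring
    simp only [mean, e, Finset.sum_add_distrib, Finset.sum_sub_distrib, ← Finset.mul_sum,
      ← Finset.sum_mul, hμ.2, one_mul]
  have hv : variance μ f = mean μ (fun s => (f s - mean μ f) ^ 2) := rfl
  rw [hv, h, h]
  ring

theorem sum_sub_sum_le_tvDist {μ ν : S → ℝ} (hμ : IsProb μ) (hν : IsProb ν) (A : Finset S) :
    ∑ s ∈ A, μ s - ∑ s ∈ A, ν s ≤ tvDist μ ν := by
  classical
  have h1 : ∑ s ∈ A, μ s - ∑ s ∈ A, ν s ≤ ∑ s ∈ A, |μ s - ν s| := by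
    rw [← Finset.sum_sub_distrib]
    exact Finset.sum_le_sum fun s _ => le_abs_self _
  have h2 : ∑ s ∈ Aᶜ, ν s - ∑ s ∈ Aᶜ, μ s ≤ ∑ s ∈ Aᶜ, |μ s - ν s| := by
    rw [← Finset.sum_sub_distrib]
    exact Finset.sum_le_sum fun s _ => by rw [abs_sub_comm]; exact le_abs_self _
  have h3 := Finset.sum_add_sum_compl A μ
  have h4 := Finset.sum_add_sum_compl A ν
  have h5 := Finset.sum_add_sum_compl A fun s => |μ s - ν s|
  rw [hμ.2] at h3
  rw [hν.2] at h4
  rw [tvDist]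
  linarith

theorem tvDist_le_one {μ ν : S → ℝ} (hμ : IsProb μ) (hν : IsProb ν) : tvDist μ ν ≤ 1 := by
  have h : ∑ s, |μ s - ν s| ≤ ∑ s, (μ s + ν s) := Finset.sum_le_sum fun s _ => by
    have h1 := hμ.1 s
    have h2 := hν.1 s
    rw [abs_le]
    constructor <;> linarith
  rw [Finset.sum_add_distrib, hμ.2, hν.2] at h
  rw [tvDist]
  linarith

/-- A statistic whose mean under `μ` is large compared with its standard deviation under `μ` and
with its size under `ν` separates `μ` from `ν`. -/
theorem one_sub_le_tvDist {μ ν : S → ℝ} (hμ : IsProb μ) (hν : IsProb ν) (f : S → ℝ)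
    (hm : 0 < mean μ f) :
    1 - 4 * (variance μ f + mean ν (fun s => f s ^ 2)) / mean μ f ^ 2 ≤ tvDist μ ν := by
  classical
  set m := mean μ f with hmdef
  -- Half the mean is the threshold: Chebyshev bounds the μ-mass below it and the ν-mass above it.
  set A : Finset S := Finset.univ.filter fun s => m / 2 ≤ f s with hA
  have hm2 : 0 < m ^ 2 := by positivity
  have h1 : ∑ s ∈ Aᶜ, μ s ≤ 4 * variance μ f / m ^ 2 := by
    have e : 4 * variance μ f / m ^ 2 = ∑ s, 4 * (μ s * (f s - m) ^ 2) / m ^ 2 := by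
      rw [variance, Finset.mul_sum, Finset.sum_div]
    rw [e]
    refine le_trans (Finset.sum_le_sum fun s hs => ?_)
      (Finset.sum_le_sum_of_subset_of_nonneg (Finset.subset_univ Aᶜ) fun s _ _ => ?_)
    · have hs' : f s < m / 2 := by simpa [hA] using hs
      rw [le_div_iff₀ hm2]
      have h3 : m ^ 2 ≤ 4 * (f s - m) ^ 2 := by nlinarith
      nlinarith [mul_le_mul_of_nonneg_left h3 (hμ.1 s)]
    · have := hμ.1 s
      positivity
  have h2 : ∑ s ∈ A, ν s ≤ 4 * mean ν (fun s => f s ^ 2) / m ^ 2 := by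
    rw [mean, Finset.mul_sum, Finset.sum_div]
    refine le_trans (Finset.sum_le_sum fun s hs => ?_)
      (Finset.sum_le_sum_of_subset_of_nonneg (Finset.subset_univ A) fun s _ _ => ?_)
    · have hs' : m / 2 ≤ f s := by simpa [hA] using hs
      rw [le_div_iff₀ hm2]
      have h3 : m ^ 2 ≤ 4 * f s ^ 2 := by nlinarith
      nlinarith [mul_le_mul_of_nonneg_left h3 (hν.1 s)]
    · have := hν.1 s
      positivity
  have h3 := Finset.sum_add_sum_compl A μ
  rw [hμ.2] at h3
  have h4 := sum_sub_sum_le_tvDist hμ hν A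
  rw [mul_add, add_div]
  linarith

/-- `Φ` decreases on average by the factor `1 - γ` in one step of `P`, up to an error `η`, and
its conditional variance in one step is at most `R`. -/
structure IsApproxEigen (P : Matrix S S ℝ) (Φ : S → ℝ) (γ η R : ℝ) : Prop where
  prob : ∀ x, IsProb (P x)
  drift : ∀ x, |mean (P x) Φ - (1 - γ) * Φ x| ≤ η
  var : ∀ x, variance (P x) Φ ≤ R

theorem mean_vecMul (P : Matrix S S ℝ) (μ f : S → ℝ) :
    mean (Matrix.vecMul μ P) f = mean μ fun x => mean (P x) f := by
  simp only [mean, Matrix.vecMul, dotProduct, Finset.sum_mul, Finset.mul_sum]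
  rw [Finset.sum_comm]
  exact Finset.sum_congr rfl fun x _ => Finset.sum_congr rfl fun y _ => by ring

theorem IsProb.vecMul {P : Matrix S S ℝ} (hP : ∀ x, IsProb (P x)) {μ : S → ℝ} (hμ : IsProb μ) :
    IsProb (Matrix.vecMul μ P) := by
  refine ⟨fun y => Finset.sum_nonneg fun x _ => mul_nonneg (hμ.1 x) ((hP x).1 y), ?_⟩
  have h := mean_vecMul P μ fun _ => 1
  have h1 : ∀ x, mean (P x) (fun _ => 1) = 1 := fun x => by simpa [mean] using (hP x).2
  simp only [h1] at h
  simpa [mean, hμ.2] using h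

theorem IsApproxEigen.abs_mean_vecMul_sub_le {P : Matrix S S ℝ} {Φ : S → ℝ} {γ η R : ℝ}
    (h : IsApproxEigen P Φ γ η R) {μ : S → ℝ} (hμ : IsProb μ) :
    |mean (Matrix.vecMul μ P) Φ - (1 - γ) * mean μ Φ| ≤ η := by
  have e : mean (Matrix.vecMul μ P) Φ - (1 - γ) * mean μ Φ
      = ∑ x, μ x * (mean (P x) Φ - (1 - γ) * Φ x) := by
    rw [mean_vecMul]
    simp only [mean, mul_sub, Finset.sum_sub_distrib, Finset.mul_sum]
    congr 1
    exact Finset.sum_congr rfl fun x _ => by ring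
  rw [e]
  refine (Finset.abs_sum_le_sum_abs _ _).trans ?_
  have : ∑ x, μ x * η = η := by rw [← Finset.sum_mul, hμ.2, one_mul]
  rw [← this]
  refine Finset.sum_le_sum fun x _ => ?_
  rw [abs_mul, abs_of_nonneg (hμ.1 x)]
  exact mul_le_mul_of_nonneg_left (h.drift x) (hμ.1 x)

/-- Recentring at (1-γ) times the old mean can only increase the second moment. The cross term
between the deviation and the drift error is absorbed by Young's inequality with weight γ, at no
cost in the rate because (1+γ)(1-γ)² ≤ 1-γ. -/
theorem IsApproxEigen.variance_vecMul_le {P : Matrix S S ℝ} {Φ : S → ℝ} {γ η R : ℝ}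
    (h : IsApproxEigen P Φ γ η R) (hγ0 : 0 < γ) (hγ1 : γ ≤ 1) {μ : S → ℝ} (hμ : IsProb μ) :
    variance (Matrix.vecMul μ P) Φ ≤ (1 - γ) * variance μ Φ + (R + 2 * η ^ 2 / γ) := by
  set c := (1 - γ) * mean μ Φ with hc
  have h1 : variance (Matrix.vecMul μ P) Φ ≤ mean (Matrix.vecMul μ P) fun s => (Φ s - c) ^ 2 := by
    rw [mean_sub_sq (hμ.vecMul h.prob)]
    linarith [sq_nonneg (mean (Matrix.vecMul μ P) Φ - c)]
  refine h1.trans ?_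
  rw [mean_vecMul]
  have h2 : ∀ x, mean (P x) (fun s => (Φ s - c) ^ 2)
      ≤ (1 - γ) * (Φ x - mean μ Φ) ^ 2 + (R + 2 * η ^ 2 / γ) := by
    intro x
    rw [mean_sub_sq (h.prob x)]
    have hv := h.var x
    have hd := h.drift x
    set e := mean (P x) Φ - (1 - γ) * Φ x with he
    have e1 : mean (P x) Φ - c = (1 - γ) * (Φ x - mean μ Φ) + e := by rw [he, hc]; ring
    rw [e1]
    set d := Φ x - mean μ Φ
    have he2 : e ^ 2 ≤ η ^ 2 := sq_le_sq' (by linarith [(abs_le.1 hd).1]) (abs_le.1 hd).2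
    have k1 : 2 * ((1 - γ) * d) * e ≤ γ * ((1 - γ) * d) ^ 2 + e ^ 2 / γ := by
      rw [← sub_nonneg]
      have e3 : γ * ((1 - γ) * d) ^ 2 + e ^ 2 / γ - 2 * ((1 - γ) * d) * e
          = (γ * ((1 - γ) * d) - e) ^ 2 / γ := by
        field_simp
        ring
      rw [e3]
      positivity
    have k2 : e ^ 2 + e ^ 2 / γ ≤ 2 * η ^ 2 / γ := by
      have : e ^ 2 ≤ e ^ 2 / γ := le_div_self (sq_nonneg e) hγ0 hγ1
      have : e ^ 2 / γ ≤ η ^ 2 / γ := by gcongr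
      rw [mul_div_assoc]
      linarith
    have k3 : (1 + γ) * ((1 - γ) * d) ^ 2 ≤ (1 - γ) * d ^ 2 := by
      have : (1 - γ) * d ^ 2 - (1 + γ) * ((1 - γ) * d) ^ 2 = γ ^ 2 * ((1 - γ) * d ^ 2) := by ring
      have h0 : 0 ≤ (1 - γ) * d ^ 2 := mul_nonneg (by linarith) (sq_nonneg d)
      have := mul_nonneg (sq_nonneg γ) h0
      linarith
    linarith
  refine (mean_mono hμ h2).trans_eq ?_
  simp only [mean, variance, mul_add, Finset.sum_add_distrib, ← Finset.sum_mul, hμ.2, one_mul,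
    Finset.mul_sum]
  congr 1
  exact Finset.sum_congr rfl fun x _ => by ring

variable [DecidableEq S]

theorem lawAt_succ (P : Matrix S S ℝ) (x : S) (t : ℕ) :
    lawAt P x (t + 1) = Matrix.vecMul (lawAt P x t) P := by
  funext y
  simp [lawAt, pow_succ, Matrix.mul_apply, Matrix.vecMul, dotProduct]

theorem lawAt_zero (P : Matrix S S ℝ) (x : S) : lawAt P x 0 = fun y => if x = y then 1 else 0 := by
  funext y
  simp [lawAt, Matrix.one_apply]

theorem isProb_lawAt {P : Matrix S S ℝ} (hP : ∀ x, IsProb (P x)) (x : S) (t : ℕ) :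
    IsProb (lawAt P x t) := by
  induction t with
  | zero =>
    rw [lawAt_zero]
    exact ⟨fun y => by dsimp only; split_ifs <;> norm_num, by simp⟩
  | succ t ih =>
    rw [lawAt_succ]
    exact ih.vecMul hP

/-- Wilson's lower bound, for an approximate eigenfunction. -/
theorem IsApproxEigen.one_sub_le_tvDist {P : Matrix S S ℝ} {Φ : S → ℝ} {γ η R : ℝ}
    (h : IsApproxEigen P Φ γ η R) (hγ0 : 0 < γ) (hγ1 : γ ≤ 1) {ν : S → ℝ}
    (hν : IsProb ν) (hst : Matrix.vecMul ν P = ν) (x : S) (t : ℕ)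
    {m : ℝ} (hm0 : 0 < m) (hm : m ≤ (1 - γ) ^ t * Φ x - η / γ) :
    1 - 4 * (2 * ((R + 2 * η ^ 2 / γ) / γ) + (η / γ) ^ 2) / m ^ 2 ≤ tvDist (lawAt P x t) ν := by
  set B := R + 2 * η ^ 2 / γ with hB
  have hη : 0 ≤ η := (abs_nonneg _).trans (h.drift x)
  have hR : 0 ≤ R := le_trans
    (Finset.sum_nonneg fun s _ => mul_nonneg ((h.prob x).1 s) (sq_nonneg _)) (h.var x)
  have hB0 : 0 ≤ B := by rw [hB]; positivity
  -- The constant η/γ is the fixed point of a ↦ (1-γ)a + η; likewise B/γ below for the variance.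
  have hmean : ∀ t, |mean (lawAt P x t) Φ - (1 - γ) ^ t * Φ x| ≤ η / γ := by
    intro t
    induction t with
    | zero =>
      have : mean (lawAt P x 0) Φ = Φ x := by simp [lawAt_zero, mean]
      rw [this]
      simp only [pow_zero, one_mul, sub_self, abs_zero]
      positivity
    | succ t ih =>
      have hs := h.abs_mean_vecMul_sub_le (isProb_lawAt h.prob x t)
      rw [← lawAt_succ] at hs
      have e : mean (lawAt P x (t + 1)) Φ - (1 - γ) ^ (t + 1) * Φ x
          = (mean (lawAt P x (t + 1)) Φ - (1 - γ) * mean (lawAt P x t) Φ)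
            + (1 - γ) * (mean (lawAt P x t) Φ - (1 - γ) ^ t * Φ x) := by ring
      rw [e]
      refine (abs_add_le _ _).trans ?_
      rw [abs_mul, abs_of_nonneg (by linarith : 0 ≤ 1 - γ)]
      have e2 : η / γ = η + (1 - γ) * (η / γ) := by
        field_simp
        ring
      rw [e2]
      exact add_le_add hs (mul_le_mul_of_nonneg_left ih (by linarith))
  have hvar : ∀ t, variance (lawAt P x t) Φ ≤ B / γ := by
    intro t
    induction t with
    | zero =>
      have : variance (lawAt P x 0) Φ = 0 := by simp [lawAt_zero, variance, mean]
      rw [this]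
      positivity
    | succ t ih =>
      have hs := h.variance_vecMul_le hγ0 hγ1 (isProb_lawAt h.prob x t)
      rw [← lawAt_succ] at hs
      have e2 : B / γ = (1 - γ) * (B / γ) + B := by
        field_simp
        ring
      rw [e2]
      exact hs.trans (add_le_add (mul_le_mul_of_nonneg_left ih (by linarith)) le_rfl)
  -- For the stationary law the one-step inequalities close up on themselves, so no explicit
  -- computation under ν is needed.
  have hνm : |mean ν Φ| ≤ η / γ := by
    have hs := h.abs_mean_vecMul_sub_le hν
    rw [hst] at hs
    have e : mean ν Φ - (1 - γ) * mean ν Φ = γ * mean ν Φ := by ring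
    rw [e, abs_mul, abs_of_pos hγ0] at hs
    rw [le_div_iff₀ hγ0]
    linarith
  have hνv : variance ν Φ ≤ B / γ := by
    have hs := h.variance_vecMul_le hγ0 hγ1 hν
    rw [hst] at hs
    rw [le_div_iff₀ hγ0]
    linarith
  have hν2 : mean ν (fun s => Φ s ^ 2) ≤ B / γ + (η / γ) ^ 2 := by
    have := mean_sub_sq hν Φ 0
    simp only [sub_zero] at this
    rw [this]
    refine add_le_add hνv ?_
    rw [← sq_abs]
    gcongr
  have hmt : m ≤ mean (lawAt P x t) Φ := by
    have := (abs_le.1 (hmean t)).1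
    linarith
  refine le_trans ?_ (OverhandShuffle.one_sub_le_tvDist (isProb_lawAt h.prob x t) hν Φ
    (hm0.trans_le hmt))
  have hv := hvar t
  have hpos : 0 ≤ 2 * (B / γ) + (η / γ) ^ 2 := by positivity
  have : 4 * (variance (lawAt P x t) Φ + mean ν (fun s => Φ s ^ 2)) / mean (lawAt P x t) Φ ^ 2
      ≤ 4 * (2 * (B / γ) + (η / γ) ^ 2) / m ^ 2 := by
    apply div_le_div₀ (by positivity) (by linarith) (by positivity)
    gcongr
  linarith

end Wilson

/-! ### Application to the overhand shuffle. -/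

section Shuffle

theorem mean_transition (p : ℝ) {n : ℕ} (σ : Equiv.Perm (Fin n))
    (f : Equiv.Perm (Fin n) → ℝ) :
    mean (transition p n σ) f = cutExp p Finset.univ fun C => f (σ * reversePackets C) := by
  simp only [mean, transition, cutExp, Finset.powerset_univ, Finset.card_univ, Fintype.card_fin,
    Finset.sum_mul]
  rw [Finset.sum_comm]
  refine Finset.sum_congr rfl fun C _ => ?_
  simp [cutProb]

theorem isProb_transition {p : ℝ} (hp0 : 0 < p) (hp1 : p < 1) {n : ℕ}
    (σ : Equiv.Perm (Fin n)) : IsProb (transition p n σ) := by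
  have hq : 0 < 1 - p := by linarith
  constructor
  · intro τ
    refine Finset.sum_nonneg fun C _ => ?_
    split_ifs
    · rw [cutProb]
      positivity
    · exact le_rfl
  · have h := mean_transition p σ fun _ => 1
    rw [cutExp_const] at h
    simpa [mean] using h

theorem sum_cutProb (p : ℝ) (n : ℕ) : ∑ C : Finset (Fin (n - 1)), cutProb p C = 1 := by
  have h := cutExp_const p (Finset.univ : Finset (Fin (n - 1))) 1
  simpa [cutExp, cutProb] using h

theorem isProb_uniform (n : ℕ) : IsProb (uniform n) := by
  refine ⟨fun σ => by rw [uniform]; positivity, ?_⟩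
  have : (n.factorial : ℝ) ≠ 0 := by positivity
  simp [uniform, Finset.card_univ, Fintype.card_perm, this]

theorem uniform_vecMul_transition (p : ℝ) (n : ℕ) :
    Matrix.vecMul (uniform n) (transition p n) = uniform n := by
  funext τ
  simp only [Matrix.vecMul, dotProduct, uniform, transition]
  rw [← Finset.mul_sum, Finset.sum_comm]
  have h : ∀ C : Finset (Fin (n - 1)), ∑ σ : Equiv.Perm (Fin n),
      (if σ * reversePackets C = τ then cutProb p C else 0) = cutProb p C := by
    intro C
    simp [← eq_mul_inv_iff_mul_eq]
  simp only [h, sum_cutProb, mul_one]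

/-- The test function, for the initial arrangement `x`: the sum over the cards of the product of
the cosines attached to the initial and to the present position. -/
noncomputable def testFun {n : ℕ} (x τ : Equiv.Perm (Fin n)) : ℝ :=
  ∑ k, Real.cos (Real.pi / n * (x⁻¹ (τ k)).val) * Real.cos (Real.pi / n * k.val)

/-- Reindexing by the involution puts the randomness into the positions; the weight, the cosine of
the card's initial position, is fixed during the step. -/
theorem testFun_mul_reversePackets {n : ℕ} (x σ : Equiv.Perm (Fin n))
    (C : Finset (Fin (n - 1))) :
    testFun x (σ * reversePackets C)
      = score (fun k => Real.cos (Real.pi / n * (x⁻¹ (σ k)).val)) C := by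
  rw [testFun, score, ← Equiv.sum_comp (reversePackets C)]
  refine Finset.sum_congr rfl fun k _ => ?_
  have h : reversePackets C (reversePackets C k) = k := reverseFun_involutive C k
  rw [Equiv.Perm.mul_apply, h]

theorem isApproxEigen_testFun {p : ℝ} (hp0 : 0 < p) (hp1 : p < 1) {n : ℕ}
    (x : Equiv.Perm (Fin n)) :
    IsApproxEigen (transition p n) (testFun x) ((Real.pi / n) ^ 2 * ((1 - p) / p ^ 2))
      (driftConst p * (Real.pi / n) ^ 2) (varConst p * (Real.pi / n)) where
  prob := isProb_transition hp0 hp1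
  drift σ := by
    rw [mean_transition]
    simp only [testFun_mul_reversePackets]
    exact abs_cutExp_score_sub_le hp0 hp1 _ fun k => Real.abs_cos_le_one _
  var σ := by
    have h := mean_sub_sq (isProb_transition hp0 hp1 σ) (testFun x) 0
    simp only [sub_zero, mean_transition, testFun_mul_reversePackets] at h
    rw [← sub_eq_iff_eq_add] at h
    rw [← h]
    exact cutExp_score_variance_le hp0 hp1 _ fun k => Real.abs_cos_le_one _

/-- A sum of cos² over half a turn: the double-angle terms are the real parts of all n-th roots of
unity, whose sum vanishes for n ≥ 2. -/
theorem testFun_self {n : ℕ} (hn : 2 ≤ n) (x : Equiv.Perm (Fin n)) :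
    testFun x x = n / 2 := by
  have h : ∑ k ∈ Finset.range n, Real.cos (2 * (Real.pi / n * k)) = 0 := by
    have hz := (Complex.isPrimitiveRoot_exp n (by omega)).geom_sum_eq_zero (by omega)
    have hre := congrArg Complex.re hz
    rw [Complex.re_sum, Complex.zero_re] at hre
    rw [← hre]
    refine Finset.sum_congr rfl fun k _ => ?_
    rw [← Complex.exp_nat_mul]
    have : (k : ℂ) * (2 * Real.pi * Complex.I / n)
        = ((2 * (Real.pi / n * k) : ℝ) : ℂ) * Complex.I := by
      push_cast
      ring
    rw [this, Complex.exp_ofReal_mul_I_re]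
  have e : ∀ a : ℝ, Real.cos a * Real.cos a = 1 / 2 + Real.cos (2 * a) / 2 := fun a => by
    rw [← sq, Real.cos_sq]
  have hx : ∀ k, x⁻¹ (x k) = k := fun k => x.symm_apply_apply k
  simp only [testFun, hx, e]
  rw [Fin.sum_univ_eq_sum_range (fun k => 1 / 2 + Real.cos (2 * (Real.pi / n * k)) / 2) n,
    Finset.sum_add_distrib, ← Finset.sum_div, ← Finset.sum_div, h]
  simp

/-- The constant in `lowerTime` gives γt ≤ (2-p)/(8(1+p)) · log n, and this coefficient is at most
1/4. With the decay rate 3/2 used below, any coefficient under 1/3 would keep the mean above √n. -/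
theorem rate_mul_le {p : ℝ} (hp0 : 0 < p) (hp1 : p < 1) {n t : ℕ} (hn : 1 ≤ n)
    (ht : (t : ℝ) ≤ lowerTime p n) :
    (Real.pi / n) ^ 2 * ((1 - p) / p ^ 2) * t ≤ Real.log n / 4 := by
  have hn' : (0 : ℝ) < n := by exact_mod_cast hn
  have hq : 0 < 1 - p := by linarith
  have hlog : 0 ≤ Real.log n := Real.log_natCast_nonneg n
  have e : (Real.pi / n) ^ 2 * ((1 - p) / p ^ 2) * lowerTime p n
      = (2 - p) / (8 * (1 + p)) * Real.log n := by
    have : 1 - p ^ 2 = (1 - p) * (1 + p) := by ring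
    rw [lowerTime, this]
    have := Real.pi_pos
    field_simp
  calc _ ≤ (Real.pi / n) ^ 2 * ((1 - p) / p ^ 2) * lowerTime p n := by gcongr
    _ = (2 - p) / (8 * (1 + p)) * Real.log n := e
    _ ≤ 1 / 4 * Real.log n := by
        refine mul_le_mul_of_nonneg_right ?_ hlog
        rw [div_le_div_iff₀ (by positivity) (by norm_num)]
        linarith
    _ = _ := by ring

theorem exp_neg_le_one_sub_pow {γ : ℝ} (hγ0 : 0 ≤ γ) (hγ1 : γ ≤ 1 / 3) (t : ℕ) :
    Real.exp (-(3 / 2) * (γ * t)) ≤ (1 - γ) ^ t := by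
  have hpos : 0 < 1 - γ := by linarith
  have h : -(3 / 2) * γ ≤ Real.log (1 - γ) := by
    refine le_trans ?_ (Real.one_sub_inv_le_log_of_pos hpos)
    rw [le_sub_iff_add_le, ← le_sub_iff_add_le', inv_le_iff_one_le_mul₀ hpos]
    nlinarith
  have h2 : (1 - γ) ^ t = Real.exp (Real.log (1 - γ) * t) := by
    rw [mul_comm, Real.exp_nat_mul, Real.exp_log hpos]
  rw [h2]
  apply Real.exp_le_exp.2
  calc _ = -(3 / 2) * γ * t := by ring
    _ ≤ _ := by gcongr

/-- Up to the time `lowerTime p n` the total variation distance to the uniform distribution is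
close to `1`, uniformly in the initial arrangement. -/
theorem exists_tendsto_one_sub_le_tvDist {p : ℝ} (hp0 : 0 < p) (hp1 : p < 1) :
    ∃ δ : ℕ → ℝ, Tendsto δ atTop (𝓝 0) ∧ ∀ᶠ n : ℕ in atTop,
      ∀ (x : Equiv.Perm (Fin n)) (t : ℕ), (t : ℝ) ≤ lowerTime p n →
        1 - δ n ≤ tvDist (lawAt (transition p n) x t) (uniform n) := by
  have hq : 0 < 1 - p := by linarith
  have hpi := Real.pi_pos
  have hM := fourthMomentBound_nonneg hp1
  have hK1 : 0 ≤ driftConst p := by rw [driftConst]; positivity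
  have hK2 : 0 ≤ varConst p := by rw [varConst]; positivity
  set r := (1 - p) / p ^ 2 with hr
  have hr0 : 0 < r := by positivity
  set A := 4 * (2 * (varConst p / (Real.pi * r) + 2 * (driftConst p / r) ^ 2)
    + (driftConst p / r) ^ 2) with hA
  -- Here y = n^(1/8), making all exponents integral: decay at least y⁻³, initial value y⁸/2, mean
  -- at least y⁵/4, variance O(y⁸), hence an error O(y⁸/y¹⁰).
  set y : ℕ → ℝ := fun n => Real.exp (Real.log n / 8) with hy
  have hyt : Tendsto y atTop atTop := Real.tendsto_exp_atTop.comp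
    ((Real.tendsto_log_atTop.comp tendsto_natCast_atTop_atTop).atTop_div_const (by norm_num))
  refine ⟨fun n => 16 * A / y n ^ 2, ?_, ?_⟩
  · exact tendsto_const_nhds.div_atTop ((tendsto_pow_atTop two_ne_zero).comp hyt)
  have hθ : Tendsto (fun n : ℕ => (Real.pi / n) ^ 2 * r) atTop (𝓝 0) := by
    have := ((tendsto_const_div_atTop_nhds_zero_nat Real.pi).pow 2).mul_const r
    simpa using this
  filter_upwards [eventually_ge_atTop 2, hyt.eventually_ge_atTop 1,
    hyt.eventually_ge_atTop (4 * (driftConst p / r)),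
    hθ.eventually_le_const (by norm_num : (0 : ℝ) < 1 / 3)] with n hn hy1 hyK hγ x t ht
  have hn0 : (0 : ℝ) < n := by positivity
  have hn1 : (1 : ℝ) ≤ n := by exact_mod_cast (by omega : 1 ≤ n)
  have hy0 : 0 < y n := Real.exp_pos _
  have hyn : y n ^ 8 = n := by
    simp only [hy]
    rw [← Real.exp_nat_mul]
    push_cast
    rw [mul_div_cancel₀ _ (by norm_num), Real.exp_log hn0]
  set γ := (Real.pi / n) ^ 2 * r with hγd
  have hγ0 : 0 < γ := by positivity
  have hηγ : driftConst p * (Real.pi / n) ^ 2 / γ = driftConst p / r := by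
    rw [hγd]
    field_simp
  have hdecay : (y n ^ 3)⁻¹ ≤ (1 - γ) ^ t := by
    refine le_trans ?_ (exp_neg_le_one_sub_pow hγ0.le hγ t)
    simp only [hy]
    rw [← Real.exp_nat_mul, ← Real.exp_neg]
    apply Real.exp_le_exp.2
    have := rate_mul_le hp0 hp1 (by omega) ht
    push_cast
    linarith
  have hm : y n ^ 5 / 4 ≤ (1 - γ) ^ t * testFun x x
      - driftConst p * (Real.pi / n) ^ 2 / γ := by
    rw [hηγ, testFun_self hn, ← hyn]
    have h1 : (y n ^ 3)⁻¹ * (y n ^ 8 / 2) = y n ^ 5 / 2 := by field_simp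
    have h2 : (y n ^ 3)⁻¹ * (y n ^ 8 / 2) ≤ (1 - γ) ^ t * (y n ^ 8 / 2) := by gcongr
    -- With y ≥ 4η/γ, the bias η/γ costs at most half of y⁵/2.
    have h3 : y n ≤ y n ^ 5 := le_self_pow₀ hy1 (by norm_num)
    linarith
  refine le_trans ?_ ((isApproxEigen_testFun hp0 hp1 x).one_sub_le_tvDist hγ0 (by linarith)
    (isProb_uniform n) (uniform_vecMul_transition p n) x t (by positivity) hm)
  rw [hηγ]
  have hnum : 4 * (2 * ((varConst p * (Real.pi / n)
      + 2 * (driftConst p * (Real.pi / n) ^ 2) ^ 2 / γ) / γ) + (driftConst p / r) ^ 2)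
      ≤ A * n := by
    have e : (varConst p * (Real.pi / n)
      + 2 * (driftConst p * (Real.pi / n) ^ 2) ^ 2 / γ) / γ
      = varConst p / (Real.pi * r) * n + 2 * (driftConst p / r) ^ 2 := by
      rw [hγd]
      field_simp
    rw [e, hA]
    have : 0 ≤ (driftConst p / r) ^ 2 := by positivity
    nlinarith
  have hfin : 16 * A / y n ^ 2 = A * n / (y n ^ 5 / 4) ^ 2 := by
    rw [← hyn]
    field_simp
    ring
  rw [hfin]
  gcongr

end Shuffle

end OverhandShuffle

/-! ### Both forms of the lower bound. -/

theorem theorem3p3 (p : ℝ) (hp0 : 0 < p) (hp1 : p < 1) :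
    OverhandShuffle.IsMixingTimeLowerBound
      (fun n => OverhandShuffle.transition p n)
      (fun n => OverhandShuffle.uniform n)
      (fun n => OverhandShuffle.lowerTime p n) ∧
    ∀ ε : ℝ, 0 < ε → ε < 1 →
      ∀ᶠ n : ℕ in Filter.atTop, ∀ (x : Equiv.Perm (Fin n)) (t : ℕ),
        OverhandShuffle.tvDist
            (OverhandShuffle.lawAt (OverhandShuffle.transition p n) x t)
            (OverhandShuffle.uniform n) ≤ ε →
          OverhandShuffle.lowerTime p n < (t : ℝ) := by
  obtain ⟨δ, hδ, h⟩ := OverhandShuffle.exists_tendsto_one_sub_le_tvDist hp0 hp1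
  constructor
  · intro x
    have h1 : Tendsto (fun n => 1 - δ n) atTop (𝓝 1) := by
      simpa using hδ.const_sub 1
    refine tendsto_of_tendsto_of_tendsto_of_le_of_le' h1 tendsto_const_nhds ?_ ?_
    · filter_upwards [h] with n hn
      refine hn (x n) _ (Nat.floor_le ?_)
      have h2 : 0 < 1 - p ^ 2 := by nlinarith
      have h3 : 0 < 2 - p := by linarith
      have h4 := Real.log_natCast_nonneg n
      rw [OverhandShuffle.lowerTime]
      positivity
    · exact Filter.Eventually.of_forall fun n => OverhandShuffle.tvDist_le_one
        (OverhandShuffle.isProb_lawAt (OverhandShuffle.isProb_transition hp0 hp1) _ _)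
        (OverhandShuffle.isProb_uniform n)
  · intro ε _ hε
    filter_upwards [h, hδ.eventually_lt_const (sub_pos.2 hε)] with n hn hδn x t htv
    -- The estimate holds at every time up to `lowerTime`, so monotonicity of the distance in t is
    -- not needed.
    by_contra hlt
    have := hn x t (not_lt.1 hlt)
    linarith
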